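/- **Corollary 2 (Blaschke–Lebesgue theorem).** A *planar convex region* is a compact convex set $K\subset\mathbb R^2$ with nonempty interior; it has *constant width* $B>0$ if any two distinct parallel tangent (supporting) lines of $K$ are at distance $B$ from each other. A *Reuleaux triangle of width $B$* is the intersection of the three closed disks of radius $B$ centred at the vertices of an equilateral triangle of side length $B$. Let $B>0$. Then Reuleaux triangles of width $B$ exist, each of them is a planar convex region of constant width $B$, and among all planar convex regions of constant width $B$ the Reuleaux triangle has the smallest area: if $T$ is a Reuleaux triangle of width $B$ and $K$ is any planar convex region of constant width $B$, then $\operatorname{area}(T)\le\operatorname{area}(K)$. Moreover the minimizer is unique up to rigid motions: if $\operatorname{area}(K)=\operatorname{area}(T)$, then $K$ is itself a Reuleaux triangle of width $B$. -/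

import Mathlib

namespace BlaschkeLebesgue

/-- The Euclidean plane. -/
abbrev Plane : Type := EuclideanSpace ℝ (Fin 2)

/-- A planar convex body (convex region): a compact convex set with nonempty interior. -/
structure IsConvexRegion (K : Set Plane) : Prop where
  convex : Convex ℝ K
  isCompact : IsCompact K
  nonempty_interior : (interior K).Nonempty

/-- For a unit vector `u`, the line `{x | ⟪u, x⟫ = a}` is tangent to `K` (a supporting line of `K`):
it meets `K`, and `K` lies on one side of it. -/
def IsTangentLine (K : Set Plane) (u : Plane) (a : ℝ) : Prop :=
  (∃ x ∈ K, inner ℝ u x = a) ∧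
    ((∀ x ∈ K, inner ℝ u x ≤ a) ∨ (∀ x ∈ K, a ≤ inner ℝ u x))

/-- `K` has constant width `B`: any two distinct parallel tangent lines of `K` are at distance `B`.
For a unit vector `u`, the distance of the parallel lines `{x | ⟪u, x⟫ = a}` and
`{x | ⟪u, x⟫ = b}` is `|a - b|`. -/
def HasConstantWidth (K : Set Plane) (B : ℝ) : Prop :=
  ∀ u : Plane, ‖u‖ = 1 → ∀ a b : ℝ, a ≠ b →
    IsTangentLine K u a → IsTangentLine K u b → |a - b| = B

/-- `T` is a Reuleaux triangle of width `B`: the intersection of the three closed disks of radius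
`B` centred at the vertices of an equilateral triangle with side length `B`. -/
def IsReuleauxTriangle (T : Set Plane) (B : ℝ) : Prop :=
  ∃ p q r : Plane, dist p q = B ∧ dist q r = B ∧ dist r p = B ∧
    T = Metric.closedBall p B ∩ Metric.closedBall q B ∩ Metric.closedBall r B

end BlaschkeLebesgue

open MeasureTheory

namespace BlaschkeLebesgue

/-! ### Planar vectors -/

/-! Write A for area and V for mixed area. Constant width means that K + (-K) is a disk of radius B,
so A(K) + A(-K) + 2V(K, -K) = πB², that is, 2A(K) = πB² - 2V(K, -K). A lower bound on the area is
thus an upper bound on V(K, -K). Mixed area is monotone, so the first K may be replaced by a polygon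
circumscribed about it. By the intermediate value theorem some regular hexagon H of width B is
circumscribed about K (`IsContactMap.exists_hexagon`). Its sides have length B/√3 and the support
values of K in opposite directions (from the centre) add up to B, so 2V(H, -K) = √3 B² for every K
(`IsContactMap.sum_hexVertex`). Hence 2A(K) ≥ (π - √3)B².

Only finite sums are needed. The contact points at 2n equally spaced normals span an inscribed
polygon, whose shoelace sum satisfies a discrete form of the identity above
(`IsContactMap.sum_cross_grid`). A sign argument for each chord replaces contact points by
circumscribed vertices, and refining the grid produces π (`IsContactMap.circumscribed_le`).

If the bound is attained, a circumscribed polygon finer than H cannot improve on it. At a vertex of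
H outside K this forces the opposite contact points to coincide, and their common position is the
opposite vertex of H (`IsHexagonCenter.contact_eq_of_minimal`, `IsHexagonCenter.mem_or_mem`).
Adjacent vertices cannot both lie in K, so K contains three alternate ones, an equilateral triangle
of side B; then K is the Reuleaux triangle on it (`IsEquilateral.eq_reuleaux`).

For the Reuleaux triangle itself an upper bound on the area suffices (`IsEquilateral.volume_le`): it
is covered by three sectors of angle π/3 that overlap in the triangle. -/

/-- The signed area of the parallelogram spanned by two vectors of the plane. -/
def cross (a b : Plane) : ℝ := a 0 * b 1 - a 1 * b 0

/-- The unit vector at angle `θ`. -/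
noncomputable def dir (θ : ℝ) : Plane := !₂[Real.cos θ, Real.sin θ]

@[simp] lemma dir_zero_coord (θ : ℝ) : dir θ 0 = Real.cos θ := rfl

@[simp] lemma dir_one_coord (θ : ℝ) : dir θ 1 = Real.sin θ := rfl

lemma inner_eq (a b : Plane) : inner ℝ a b = a 0 * b 0 + a 1 * b 1 := by
  simp [PiLp.inner_apply, Fin.sum_univ_two, mul_comm]

lemma norm_sq_eq (a : Plane) : ‖a‖ ^ 2 = a 0 ^ 2 + a 1 ^ 2 := by
  rw [← real_inner_self_eq_norm_sq, inner_eq]; ring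

lemma plane_ext {a b : Plane} (h0 : a 0 = b 0) (h1 : a 1 = b 1) : a = b := by
  ext i; fin_cases i <;> assumption

@[simp] lemma norm_dir (θ : ℝ) : ‖dir θ‖ = 1 := by
  have h := norm_sq_eq (dir θ)
  rw [dir_zero_coord, dir_one_coord, Real.cos_sq_add_sin_sq] at h
  exact (pow_eq_one_iff_of_nonneg (norm_nonneg _) two_ne_zero).1 h

lemma dir_add_pi (θ : ℝ) : dir (θ + Real.pi) = -dir θ := by
  apply plane_ext <;> simp

lemma dir_add_two_pi (θ : ℝ) : dir (θ + 2 * Real.pi) = dir θ := by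
  apply plane_ext <;> simp

lemma cross_dir (α β : ℝ) : cross (dir α) (dir β) = Real.sin (β - α) := by
  simp only [cross, dir_zero_coord, dir_one_coord, Real.sin_sub]; ring

lemma continuous_dir : Continuous dir := by
  unfold dir; fun_prop

lemma cross_sub_left (a b c : Plane) : cross (a - b) c = cross a c - cross b c := by
  simp only [cross, PiLp.sub_apply]; ring

lemma cross_sub_right (a b c : Plane) : cross a (b - c) = cross a b - cross a c := by
  simp only [cross, PiLp.sub_apply]; ring

lemma cross_add_left (a b c : Plane) : cross (a + b) c = cross a c + cross b c := by
  simp only [cross, PiLp.add_apply]; ring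

lemma cross_add_right (a b c : Plane) : cross a (b + c) = cross a b + cross a c := by
  simp only [cross, PiLp.add_apply]; ring

lemma cross_smul_left (t : ℝ) (a b : Plane) : cross (t • a) b = t * cross a b := by
  simp only [cross, PiLp.smul_apply, smul_eq_mul]; ring

lemma cross_smul_right (t : ℝ) (a b : Plane) : cross a (t • b) = t * cross a b := by
  simp only [cross, PiLp.smul_apply, smul_eq_mul]; ring

lemma cross_comm (a b : Plane) : cross a b = -cross b a := by
  simp only [cross]; ring

@[simp] lemma cross_self (a : Plane) : cross a a = 0 := by
  simp only [cross]; ring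

@[simp] lemma cross_zero_left (a : Plane) : cross 0 a = 0 := by simp [cross]

@[simp] lemma cross_zero_right (a : Plane) : cross a 0 = 0 := by simp [cross]

/-- The Binet–Cauchy identity in the plane. -/
lemma cross_mul_cross (m n a b : Plane) :
    cross m n * cross a b = inner ℝ m a * inner ℝ n b - inner ℝ n a * inner ℝ m b := by
  simp only [cross, inner_eq]; ring

/-- Cramer's rule in the plane. -/
lemma cross_smul_eq (a b c : Plane) :
    cross a b • c = cross c b • a + cross a c • b := by
  apply plane_ext <;> simp only [cross, PiLp.smul_apply, PiLp.add_apply, smul_eq_mul] <;> ring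

/-- In the Binet–Cauchy identity both products have a favourable sign. This is the local form of the
monotonicity of mixed area: `z` will be a chord of the opposite arc and `w` the offset from a
contact point to a circumscribed vertex. -/
lemma cross_nonneg_of_inner {m n z w : Plane} (hmn : 0 < cross m n)
    (h1 : 0 ≤ inner ℝ m z) (h2 : inner ℝ n z ≤ 0) (h3 : 0 ≤ inner ℝ m w)
    (h4 : 0 ≤ inner ℝ n w) : 0 ≤ cross z w := by
  have h := cross_mul_cross m n z w
  have : 0 ≤ cross m n * cross z w := by
    rw [h]; nlinarith [mul_nonneg h1 h4, mul_nonneg (neg_nonneg.2 h2) h3]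
  exact nonneg_of_mul_nonneg_right this hmn

/-- A vector orthogonal to two linearly independent ones vanishes. -/
lemma eq_zero_of_inner {m n z : Plane} (hmn : cross m n ≠ 0)
    (h1 : inner ℝ m z = 0) (h2 : inner ℝ n z = 0) : z = 0 := by
  rw [inner_eq] at h1 h2
  apply plane_ext
  · have : cross m n * z 0 = 0 := by
      simp only [cross]; linear_combination n 1 * h1 - m 1 * h2
    simpa [hmn] using this
  · have : cross m n * z 1 = 0 := by
      simp only [cross]; linear_combination m 0 * h2 - n 0 * h1
    simpa [hmn] using this

/-- Two non-parallel lines meet. -/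
lemma exists_inner_eq {m n : Plane} (hmn : cross m n ≠ 0) (a b : ℝ) :
    ∃ v : Plane, inner ℝ m v = a ∧ inner ℝ n v = b := by
  refine ⟨!₂[(a * n 1 - b * m 1) / cross m n, (b * m 0 - a * n 0) / cross m n], ?_, ?_⟩ <;>
  · rw [inner_eq]
    simp only [Matrix.cons_val_zero, Matrix.cons_val_one]
    field_simp
    simp only [cross]
    ring

/-- A direction between two others is a nonnegative combination of them. -/
lemma sin_smul_dir (α β γ : ℝ) :
    Real.sin (γ - α) • dir β = Real.sin (γ - β) • dir α + Real.sin (β - α) • dir γ := by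
  simpa [cross_dir] using cross_smul_eq (dir α) (dir γ) (dir β)

lemma sin_mul_inner_dir (α β γ : ℝ) (w : Plane) :
    Real.sin (γ - α) * inner ℝ (dir β) w =
      Real.sin (γ - β) * inner ℝ (dir α) w + Real.sin (β - α) * inner ℝ (dir γ) w := by
  rw [← real_inner_smul_left, sin_smul_dir, inner_add_left, real_inner_smul_left,
    real_inner_smul_left]

/-! ### Sets of constant width -/

section Width

variable {K : Set Plane} {B : ℝ}

lemma IsConvexRegion.nonempty (hK : IsConvexRegion K) : K.Nonempty :=
  hK.nonempty_interior.mono interior_subset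

lemma IsConvexRegion.exists_max (hK : IsConvexRegion K) (u : Plane) :
    ∃ x ∈ K, ∀ k ∈ K, inner ℝ u k ≤ inner ℝ u x :=
  hK.isCompact.exists_isMaxOn hK.nonempty
    (Continuous.continuousOn (f := fun k : Plane => inner ℝ u k) (by fun_prop))

lemma IsConvexRegion.exists_min (hK : IsConvexRegion K) (u : Plane) :
    ∃ x ∈ K, ∀ k ∈ K, inner ℝ u x ≤ inner ℝ u k :=
  hK.isCompact.exists_isMinOn hK.nonempty
    (Continuous.continuousOn (f := fun k : Plane => inner ℝ u k) (by fun_prop))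

/-- The difference of the extreme values of a unit functional is the width. -/
lemma inner_sub_inner_eq (hK : IsConvexRegion K) (hw : HasConstantWidth K B) {u x y : Plane}
    (hu : ‖u‖ = 1) (hx : x ∈ K) (hxm : ∀ k ∈ K, inner ℝ u k ≤ inner ℝ u x)
    (hy : y ∈ K) (hym : ∀ k ∈ K, inner ℝ u y ≤ inner ℝ u k) :
    inner ℝ u x - inner ℝ u y = B := by
  -- The width condition speaks of distinct tangent lines only; an interior point shows that the two
  -- extreme ones differ.
  have hlt : inner ℝ u y < inner ℝ u x := by
    obtain ⟨c, hc⟩ := hK.nonempty_interior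
    obtain ⟨ε, hε, hball⟩ := Metric.mem_nhds_iff.1 (mem_interior_iff_mem_nhds.1 hc)
    have hmem : c + (ε / 2) • u ∈ K := by
      apply hball
      rw [Metric.mem_ball, dist_eq_norm, add_sub_cancel_left, norm_smul, hu, mul_one,
        Real.norm_of_nonneg (by positivity)]
      linarith
    have h1 := hym c (interior_subset hc)
    have h2 := hxm _ hmem
    rw [inner_add_right, real_inner_smul_right, real_inner_self_eq_norm_sq, hu] at h2
    linarith
  have h := hw u hu _ _ hlt.ne' ⟨⟨x, hx, rfl⟩, Or.inl hxm⟩ ⟨⟨y, hy, rfl⟩, Or.inr hym⟩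
  rwa [abs_of_pos (sub_pos.2 hlt)] at h

/-- Projecting to the direction of `x - y` preserves this distance, and the projection of `K` has
length `B`. -/
lemma dist_le_of_hasConstantWidth (hK : IsConvexRegion K) (hw : HasConstantWidth K B)
    (hB : 0 < B) {x y : Plane} (hx : x ∈ K) (hy : y ∈ K) : dist x y ≤ B := by
  rcases eq_or_ne x y with rfl | hne
  · simpa using hB.le
  have hd : ‖x - y‖ ≠ 0 := norm_ne_zero_iff.2 (sub_ne_zero.2 hne)
  set u : Plane := ‖x - y‖⁻¹ • (x - y) with hu_def
  have hu : ‖u‖ = 1 := by rw [hu_def, norm_smul, norm_inv, norm_norm, inv_mul_cancel₀ hd]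
  obtain ⟨a, ha, ham⟩ := hK.exists_max u
  obtain ⟨b, hb, hbm⟩ := hK.exists_min u
  have h := inner_sub_inner_eq hK hw hu ha ham hb hbm
  have h1 : inner ℝ u (x - y) = ‖x - y‖ := by
    rw [hu_def, real_inner_smul_left, real_inner_self_eq_norm_sq]; field_simp
  rw [inner_sub_right] at h1
  rw [dist_eq_norm]
  linarith [ham x hx, hbm y hy]

/-- Contact points with opposite tangent lines are opposite ends of a common normal. -/
lemma eq_sub_smul_of_extremal (hK : IsConvexRegion K) (hw : HasConstantWidth K B)
    (hB : 0 < B) {u x y : Plane}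
    (hu : ‖u‖ = 1) (hx : x ∈ K) (hxm : ∀ k ∈ K, inner ℝ u k ≤ inner ℝ u x)
    (hy : y ∈ K) (hym : ∀ k ∈ K, inner ℝ u y ≤ inner ℝ u k) : y = x - B • u := by
  have h := inner_sub_inner_eq hK hw hu hx hxm hy hym
  have hd := dist_le_of_hasConstantWidth hK hw hB hx hy
  rw [dist_eq_norm] at hd
  -- The component of `x - y` along `u` is already `B`, and its length is at most `B`, so nothing is
  -- left orthogonally to `u`.
  have h2 : ‖(x - y) - B • u‖ ^ 2 ≤ 0 := by
    rw [norm_sub_sq_real, real_inner_smul_right, norm_smul, hu, real_inner_comm, inner_sub_right,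
      h, Real.norm_of_nonneg hB.le]
    nlinarith [norm_nonneg (x - y)]
  have h3 : (x - y) - B • u = 0 := by
    rw [← norm_eq_zero]; nlinarith [norm_nonneg ((x - y) - B • u)]
  rw [eq_sub_iff_add_eq, ← sub_eq_zero, ← neg_eq_zero, ← h3]; abel

/-- `x θ` is a contact point of `K` with its tangent line of outer normal `dir θ`, and opposite
contact points are at distance `B` along the normal. -/
structure IsContactMap (K : Set Plane) (B : ℝ) (x : ℝ → Plane) : Prop where
  mem : ∀ θ, x θ ∈ K
  le : ∀ θ, ∀ k ∈ K, inner ℝ (dir θ) k ≤ inner ℝ (dir θ) (x θ)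
  add_pi : ∀ θ, x (θ + Real.pi) = x θ - B • dir θ

lemma exists_isContactMap (hK : IsConvexRegion K) (hw : HasConstantWidth K B) (hB : 0 < B) :
    ∃ x, IsContactMap K B x := by
  choose x hx hxm using fun θ => hK.exists_max (dir θ)
  refine ⟨x, hx, hxm, fun θ => ?_⟩
  refine eq_sub_smul_of_extremal hK hw hB (norm_dir θ) (hx θ) (hxm θ) (hx _) fun k hk => ?_
  have := hxm (θ + Real.pi) k hk
  rw [dir_add_pi, inner_neg_left, inner_neg_left] at this
  linarith

lemma IsContactMap.add_two_pi {x : ℝ → Plane} (hx : IsContactMap K B x) (θ : ℝ) :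
    x (θ + 2 * Real.pi) = x θ := by
  have : θ + 2 * Real.pi = θ + Real.pi + Real.pi := by ring
  rw [this, hx.add_pi, hx.add_pi, dir_add_pi]; simp

end Width

/-! ### Areas of triangles and inscribed polygons -/

/-- The triangle with vertices `0`, `a`, `b` (positively oriented), without two of its sides. -/
def tri (a b : Plane) : Set Plane :=
  {c | 0 < cross c b ∧ 0 < cross a c ∧ cross c b + cross a c ≤ cross a b}

lemma continuous_cross {X : Type*} [TopologicalSpace X] {f g : X → Plane} (hf : Continuous f)
    (hg : Continuous g) : Continuous fun x => cross (f x) (g x) := by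
  unfold cross; fun_prop

lemma measurableSet_tri (a b : Plane) : MeasurableSet (tri a b) := by
  have h1 : Continuous fun c => cross c b := continuous_cross continuous_id continuous_const
  have h2 : Continuous fun c => cross a c := continuous_cross continuous_const continuous_id
  exact ((isOpen_lt continuous_const h1).measurableSet).inter
    (((isOpen_lt continuous_const h2).measurableSet).inter
      (isClosed_le (h1.add h2) continuous_const).measurableSet)

/-- The map with coordinates `cross c b` and `cross a c` has determinant `cross a b` =: D and
carries the parallelogram to the square of side D; the area is D² / D. -/
lemma volume_open_parallelogram {a b : Plane} (h : 0 < cross a b) :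
    volume {c : Plane | (0 < cross c b ∧ cross c b < cross a b) ∧
      (0 < cross a c ∧ cross a c < cross a b)} = ENNReal.ofReal (cross a b) := by
  set D := cross a b with hD
  set f : Plane →ₗ[ℝ] Plane := Matrix.toLpLin 2 2 !![b 1, -b 0; -a 1, a 0] with hf
  have hdet : LinearMap.det f = D := by
    rw [hf, Matrix.toLpLin_eq_toLin, LinearMap.det_toLin, Matrix.det_fin_two_of, hD, cross]
    ring
  have hset : {c : Plane | (0 < cross c b ∧ cross c b < D) ∧ (0 < cross a c ∧ cross a c < D)} =
      f ⁻¹' ((MeasurableEquiv.toLp 2 (Fin 2 → ℝ)).symm ⁻¹'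
        (Set.univ.pi fun _ => Set.Ioo 0 D)) := by
    ext c
    simp only [Set.mem_ofPred_eq, Set.mem_preimage, Set.mem_pi, Set.mem_univ, true_implies,
      Fin.forall_fin_two, Set.mem_Ioo]
    have h0 : f c 0 = cross c b := by
      simp [hf, Matrix.toLpLin_apply, dotProduct, Fin.sum_univ_two, cross]
      ring
    have h1 : f c 1 = cross a c := by
      simp [hf, Matrix.toLpLin_apply, dotProduct, Fin.sum_univ_two, cross]
      ring
    change _ ↔ (0 < f c 0 ∧ f c 0 < D) ∧ (0 < f c 1 ∧ f c 1 < D)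
    rw [h0, h1]
  rw [hset, Measure.addHaar_preimage_linearMap _ (by rw [hdet]; exact h.ne'), hdet,
    (EuclideanSpace.volume_preserving_symm_measurableEquiv_toLp (Fin 2)).measure_preimage
      (MeasurableSet.univ_pi fun _ => measurableSet_Ioo).nullMeasurableSet,
    Real.volume_pi_Ioo, Fin.prod_univ_two, sub_zero, ← ENNReal.ofReal_mul h.le,
    ← ENNReal.ofReal_mul (abs_nonneg _), abs_of_pos (inv_pos.2 h)]
  congr 1
  field_simp

/-- The point reflection `c ↦ a + b - c` exchanges the two halves of the parallelogram, so the
triangle and its reflection cover it. -/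
lemma ofReal_cross_le_volume_tri (a b : Plane) :
    ENNReal.ofReal (cross a b) ≤ 2 * volume (tri a b) := by
  rcases le_or_gt (cross a b) 0 with h | h
  · simp [ENNReal.ofReal_of_nonpos h]
  rw [← volume_open_parallelogram h, two_mul]
  have hrefl : volume ((fun c => (a + b) - c) ⁻¹' tri a b) = volume (tri a b) :=
    (Measure.measurePreserving_sub_left volume (a + b)).measure_preimage
      (measurableSet_tri a b).nullMeasurableSet
  nth_rewrite 2 [← hrefl]
  refine (measure_mono ?_).trans (measure_union_le _ _)
  rintro c ⟨⟨h1, h2⟩, h3, h4⟩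
  rcases le_or_gt (cross c b + cross a c) (cross a b) with h5 | h5
  · exact Or.inl ⟨h1, h3, h5⟩
  · right
    simp only [Set.mem_preimage, tri, Set.mem_ofPred_eq, cross_sub_left, cross_sub_right,
      cross_add_left, cross_add_right, cross_self]
    refine ⟨?_, ?_, ?_⟩ <;> linarith

lemma add_mem_of_mem_tri {K : Set Plane} (hK : Convex ℝ K) {o a b c : Plane} (ho : o ∈ K)
    (ha : o + a ∈ K) (hb : o + b ∈ K) (hc : c ∈ tri a b) : o + c ∈ K := by
  obtain ⟨h1, h2, h3⟩ := hc
  have hD : 0 < cross a b := by linarith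
  have hcomb : o + c = ((cross a b - cross c b - cross a c) / cross a b) • o +
      (cross c b / cross a b) • (o + a) + (cross a c / cross a b) • (o + b) := by
    have h := cross_smul_eq a b c
    have : c = (cross c b / cross a b) • a + (cross a c / cross a b) • b := by
      rw [div_eq_inv_mul, div_eq_inv_mul, mul_smul, mul_smul, ← smul_add, ← h, smul_smul,
        inv_mul_cancel₀ hD.ne', one_smul]
    have h1 : (cross a b - cross c b - cross a c) / cross a b + cross c b / cross a b +
        cross a c / cross a b = 1 := by field_simp; ring
    calc o + c = ((cross a b - cross c b - cross a c) / cross a b + cross c b / cross a b +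
        cross a c / cross a b) • o +
          ((cross c b / cross a b) • a + (cross a c / cross a b) • b) := by
          rw [h1, one_smul, ← this]
      _ = _ := by module
  have hs := hK.sum_mem (t := Finset.univ) (w := ![(cross a b - cross c b - cross a c) / cross a b,
    cross c b / cross a b, cross a c / cross a b]) (z := ![o, o + a, o + b]) ?_ ?_ ?_
  · rw [hcomb]
    simpa [Fin.sum_univ_three] using hs
  · intro i _
    fin_cases i
    · exact div_nonneg (by linarith) hD.le
    · exact div_nonneg h1.le hD.le
    · exact div_nonneg h2.le hD.le
  · simp only [Fin.sum_univ_three, Matrix.cons_val_zero, Matrix.cons_val_one, Matrix.cons_val]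
    field_simp
    ring
  · intro i _
    fin_cases i
    · exact ho
    · exact ha
    · exact hb

/-- The area of a polygon inscribed in a convex set, triangulated from its first vertex. -/
lemma sum_cross_sub_le_volume {K : Set Plane} (hK : Convex ℝ K) (P : ℕ → Plane) (n : ℕ)
    (hP : ∀ i, P i ∈ K)
    (hor : ∀ i j, i ≤ j → j ≤ n → 0 ≤ cross (P i - P 0) (P j - P 0)) :
    ENNReal.ofReal (∑ j ∈ Finset.range n, cross (P j - P 0) (P (j + 1) - P 0)) ≤
      2 * volume K := by
  set T : ℕ → Set Plane := fun j => (fun y => y - P 0) ⁻¹' tri (P j - P 0) (P (j + 1) - P 0)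
    with hT
  have hmeas : ∀ j, MeasurableSet (T j) := fun j =>
    (measurableSet_tri _ _).preimage (measurable_id.sub_const _)
  have hvol : ∀ j, volume (T j) = volume (tri (P j - P 0) (P (j + 1) - P 0)) := fun j =>
    (measurePreserving_sub_right volume (P 0)).measure_preimage
      (measurableSet_tri _ _).nullMeasurableSet
  have hlt : ∀ i j, i < j → j < n → Disjoint (T i) (T j) := by
    intro i j hij hj
    rw [Set.disjoint_left]
    rintro y ⟨h1, h2, h3⟩ ⟨_, h5, _⟩
    have hD : 0 < cross (P i - P 0) (P (i + 1) - P 0) := by linarith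
    -- A point of the earlier triangle is a positive combination of two rays that do not lie beyond
    -- the ray of `P j`, so it cannot lie strictly beyond that ray, as points of the later triangle
    -- do.
    have e := congrArg (cross (P j - P 0)) (cross_smul_eq (P i - P 0) (P (i + 1) - P 0) (y - P 0))
    rw [cross_smul_right, cross_add_right, cross_smul_right, cross_smul_right,
      cross_comm (P j - P 0) (P i - P 0), cross_comm (P j - P 0) (P (i + 1) - P 0)] at e
    have q1 := hor i j hij.le hj.le
    have q2 := hor (i + 1) j hij hj.le
    nlinarith [mul_pos hD h5, mul_nonneg h1.le q1, mul_nonneg h2.le q2]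
  have hdisj : Set.PairwiseDisjoint (↑(Finset.range n)) T := by
    intro i hi j hj hij
    simp only [Finset.coe_range, Set.mem_Iio] at hi hj
    rcases lt_or_gt_of_ne hij with h | h
    · exact hlt i j h hj
    · exact (hlt j i h hi).symm
  have hsub : (⋃ j ∈ Finset.range n, T j) ⊆ K := by
    intro y hy
    simp only [Set.mem_iUnion] at hy
    obtain ⟨j, _, hy⟩ := hy
    have := add_mem_of_mem_tri hK (hP 0) (by rw [add_sub_cancel]; exact hP j)
      (by rw [add_sub_cancel]; exact hP (j + 1)) hy
    rwa [add_sub_cancel] at this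
  calc ENNReal.ofReal (∑ j ∈ Finset.range n, cross (P j - P 0) (P (j + 1) - P 0))
      = ∑ j ∈ Finset.range n, ENNReal.ofReal (cross (P j - P 0) (P (j + 1) - P 0)) :=
        ENNReal.ofReal_sum_of_nonneg fun j hj =>
          hor j (j + 1) (Nat.le_succ j) (Finset.mem_range.1 hj)
    _ ≤ ∑ j ∈ Finset.range n, 2 * volume (T j) := by
        refine Finset.sum_le_sum fun j _ => ?_
        rw [hvol]
        exact ofReal_cross_le_volume_tri _ _
    _ = 2 * volume (⋃ j ∈ Finset.range n, T j) := by
        rw [← Finset.mul_sum, measure_biUnion_finset hdisj fun j _ => hmeas j]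
    _ ≤ 2 * volume K := by gcongr

/-- The shoelace formula bounds the area of a convex set from below. -/
lemma sum_cross_le_volume {K : Set Plane} (hK : Convex ℝ K) (P : ℕ → Plane) (n : ℕ)
    (hP : ∀ i, P i ∈ K) (hclosed : P n = P 0)
    (hor : ∀ i j, i ≤ j → j ≤ n → 0 ≤ cross (P i - P 0) (P j - P 0)) :
    ENNReal.ofReal (∑ j ∈ Finset.range n, cross (P j) (P (j + 1))) ≤ 2 * volume K := by
  convert sum_cross_sub_le_volume hK P n hP hor using 2
  -- Moving the origin to `P 0` changes the summands by differences that telescope around the closed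
  -- polygon.
  have h : ∀ j, cross (P j - P 0) (P (j + 1) - P 0) =
      cross (P j) (P (j + 1)) - (cross (P 0) (P (j + 1)) - cross (P 0) (P j)) := by
    intro j
    rw [cross_sub_left, cross_sub_right, cross_sub_right, cross_self, cross_comm (P j) (P 0)]
    ring
  simp only [h]
  rw [Finset.sum_sub_distrib, Finset.sum_range_sub (fun j => cross (P 0) (P j)), hclosed]
  simp

/-! ### Orientation of contact points -/

section Contact

variable {K : Set Plane} {B : ℝ} {x : ℝ → Plane}

/-- The points `a`, `b`, `c` are highest among the three in the directions `m`, `n`, `l`. If the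
triangle were negatively oriented, the pair `m`, `n` would put `c` strictly above `a` in direction
`n`, and the pair `n`, `l` would put `a` strictly above `c`. -/
lemma cross_nonneg_of_gaps {a b c m n l : Plane} (hmn : 0 < cross m n) (hnl : 0 < cross n l)
    (hab : inner ℝ m b ≤ inner ℝ m a) (hac : inner ℝ m c ≤ inner ℝ m a)
    (hba : inner ℝ n a ≤ inner ℝ n b) (hbc : inner ℝ n c ≤ inner ℝ n b)
    (hca : inner ℝ l a ≤ inner ℝ l c) (hcb : inner ℝ l b ≤ inner ℝ l c) :
    0 ≤ cross (b - a) (c - a) := by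
  have h1 := cross_mul_cross m n (b - a) (c - a)
  have h2 := cross_mul_cross n l (b - a) (c - a)
  simp only [inner_sub_right] at h1 h2
  by_contra! hD
  have k1 := mul_neg_of_pos_of_neg hmn hD
  have k2 := mul_neg_of_pos_of_neg hnl hD
  rw [h1] at k1
  rw [h2] at k2
  obtain ⟨e12, he12⟩ : ∃ e, e = inner ℝ m a - inner ℝ m b := ⟨_, rfl⟩
  obtain ⟨e13, he13⟩ : ∃ e, e = inner ℝ m a - inner ℝ m c := ⟨_, rfl⟩
  obtain ⟨e21, he21⟩ : ∃ e, e = inner ℝ n b - inner ℝ n a := ⟨_, rfl⟩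
  obtain ⟨e23, he23⟩ : ∃ e, e = inner ℝ n b - inner ℝ n c := ⟨_, rfl⟩
  obtain ⟨e31, he31⟩ : ∃ e, e = inner ℝ l c - inner ℝ l a := ⟨_, rfl⟩
  obtain ⟨e32, he32⟩ : ∃ e, e = inner ℝ l c - inner ℝ l b := ⟨_, rfl⟩
  have p12 : 0 ≤ e12 := by linarith
  have p13 : 0 ≤ e13 := by linarith
  have p21 : 0 ≤ e21 := by linarith
  have p23 : 0 ≤ e23 := by linarith
  have p31 : 0 ≤ e31 := by linarith
  have p32 : 0 ≤ e32 := by linarith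
  have q1 : e12 * e23 + e21 * e13 - e12 * e21 < 0 := by
    rw [he12, he13, he21, he23]; linarith
  have q2 : e23 * e31 + e32 * e21 - e23 * e32 < 0 := by
    rw [he31, he32, he21, he23]; linarith
  have r1 : e23 < e21 := by
    by_contra! h
    nlinarith [mul_nonneg p21 p13, mul_nonneg p12 (sub_nonneg.2 h)]
  have r2 : e21 < e23 := by
    by_contra! h
    nlinarith [mul_nonneg p23 p31, mul_nonneg p32 (sub_nonneg.2 h)]
  exact lt_asymm r1 r2

/-- Contact points follow the cyclic order of their normals. The three angular gaps add up to a full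
turn, so at most one can exceed π without leaving two usable ones; a cyclic relabelling puts the two
short gaps first. -/
lemma IsContactMap.cross_nonneg (hx : IsContactMap K B x) {α β γ : ℝ} (h1 : α ≤ β) (h2 : β ≤ γ)
    (h3 : γ ≤ α + 2 * Real.pi) : 0 ≤ cross (x β - x α) (x γ - x α) := by
  rcases h1.eq_or_lt with rfl | h1
  · simp
  rcases h2.eq_or_lt with rfl | h2
  · simp
  rcases h3.eq_or_lt with rfl | h3
  · simp [hx.add_two_pi]
  have hs : ∀ {s t : ℝ}, s < t → t < s + Real.pi → 0 < cross (dir s) (dir t) := by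
    intro s t hst ht
    rw [cross_dir]
    exact Real.sin_pos_of_pos_of_lt_pi (by linarith) (by linarith)
  have hl := fun θ φ => hx.le θ (x φ) (hx.mem φ)
  have hs' : α + Real.pi < γ → 0 < cross (dir γ) (dir α) := by
    intro h
    rw [← dir_add_two_pi α]
    exact hs h3 (by linarith)
  have cyc : ∀ a b c : Plane, cross (b - a) (c - a) = cross (c - b) (a - b) := by
    intro a b c; simp only [cross, PiLp.sub_apply]; ring
  rcases le_or_gt (α + Real.pi) β with g1 | g1
  · rw [cyc (x α)]
    exact cross_nonneg_of_gaps (hs h2 (by linarith)) (hs' (by linarith)) (hl _ _) (hl _ _)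
      (hl _ _) (hl _ _) (hl _ _) (hl _ _)
  · rcases le_or_gt (β + Real.pi) γ with g2 | g2
    · rw [cyc (x α), cyc (x β)]
      exact cross_nonneg_of_gaps (hs' (by linarith)) (hs h1 g1) (hl _ _) (hl _ _)
        (hl _ _) (hl _ _) (hl _ _) (hl _ _)
    · exact cross_nonneg_of_gaps (hs h1 g1) (hs h2 g2) (hl _ _) (hl _ _)
        (hl _ _) (hl _ _) (hl _ _) (hl _ _)

end Contact

/-! ### The discretized mixed area inequality -/

/-- The angles that subdivide each half turn from `θ` on into `n` equal parts. -/
noncomputable def grid (θ : ℝ) (n j : ℕ) : ℝ := θ + j * (Real.pi / n)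

lemma grid_add_self (θ : ℝ) {n : ℕ} (hn : 0 < n) (j : ℕ) :
    grid θ n (j + n) = grid θ n j + Real.pi := by
  have : (n : ℝ) ≠ 0 := by positivity
  simp only [grid, Nat.cast_add]
  field_simp
  ring

lemma grid_succ (θ : ℝ) (n j : ℕ) : grid θ n (j + 1) = grid θ n j + Real.pi / n := by
  simp only [grid, Nat.cast_add, Nat.cast_one]
  ring

lemma grid_mul (θ : ℝ) (n : ℕ) {M : ℕ} (hM : 0 < M) (k : ℕ) :
    grid θ (n * M) (k * M) = grid θ n k := by
  have : (M : ℝ) ≠ 0 := by positivity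
  simp only [grid, Nat.cast_mul]
  rcases eq_or_ne (n : ℝ) 0 with h | h
  · simp [h]
  · field_simp

lemma grid_mono (θ : ℝ) (n : ℕ) : Monotone (grid θ n) := by
  intro i j hij
  have : (i : ℝ) ≤ j := by exact_mod_cast hij
  have hpi := Real.pi_pos.le
  simp only [grid]
  gcongr

lemma inner_dir_nonneg_of_mem_Icc {α β γ : ℝ} {w : Plane} (h1 : α ≤ β) (h2 : β ≤ γ) (h3 : α < γ)
    (h4 : γ < α + Real.pi) (hα : 0 ≤ inner ℝ (dir α) w) (hγ : 0 ≤ inner ℝ (dir γ) w) :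
    0 ≤ inner ℝ (dir β) w := by
  have hs : 0 < Real.sin (γ - α) := Real.sin_pos_of_pos_of_lt_pi (by linarith) (by linarith)
  have hs1 : 0 ≤ Real.sin (γ - β) :=
    Real.sin_nonneg_of_nonneg_of_le_pi (by linarith) (by linarith)
  have hs2 : 0 ≤ Real.sin (β - α) :=
    Real.sin_nonneg_of_nonneg_of_le_pi (by linarith) (by linarith)
  have h := sin_mul_inner_dir α β γ w
  have : 0 ≤ Real.sin (γ - α) * inner ℝ (dir β) w := by rw [h]; positivity
  exact nonneg_of_mul_nonneg_right this hs

lemma sum_range_two_mul (f : ℕ → ℝ) (n : ℕ) :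
    ∑ j ∈ Finset.range (2 * n), f j = ∑ j ∈ Finset.range n, (f j + f (j + n)) := by
  rw [two_mul, Finset.sum_range_add, Finset.sum_add_distrib]
  simp only [add_comm]

/-- With the same `v k` on `M` consecutive chords, these chords telescope to one chord of the coarse
grid. Hence refinement does not change the mixed sum. -/
lemma sum_cross_div (v Y : ℕ → Plane) {M : ℕ} (hM : 0 < M) (m : ℕ) :
    ∑ j ∈ Finset.range (m * M), cross (v (j / M)) (Y (j + 1) - Y j) =
      ∑ k ∈ Finset.range m, cross (v k) (Y ((k + 1) * M) - Y (k * M)) := by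
  induction m with
  | zero => simp
  | succ m ih =>
    rw [add_mul, one_mul, Finset.sum_range_add, ih, Finset.sum_range_succ]
    congr 1
    have h : ∀ l ∈ Finset.range M, cross (v ((m * M + l) / M)) (Y (m * M + l + 1) - Y (m * M + l)) =
        cross (v m) (Y (m * M + (l + 1))) - cross (v m) (Y (m * M + l)) := by
      intro l hl
      rw [mul_comm m M, Nat.mul_add_div hM, Nat.div_eq_of_lt (Finset.mem_range.1 hl), add_zero,
        cross_sub_right, add_assoc, mul_comm M m]
    rw [Finset.sum_congr rfl h, Finset.sum_range_sub (fun l => cross (v m) (Y (m * M + l))),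
      cross_sub_right, add_zero, add_mul, one_mul]

lemma tendsto_mul_sin_pi_div :
    Filter.Tendsto (fun N : ℕ => (N : ℝ) * Real.sin (Real.pi / N)) Filter.atTop
      (nhds Real.pi) := by
  have h1 : Filter.Tendsto (fun N : ℕ => Real.pi * Real.sinc (Real.pi / N)) Filter.atTop
      (nhds (Real.pi * Real.sinc 0)) :=
    ((Real.continuous_sinc.tendsto 0).comp
      (tendsto_const_div_atTop_nhds_zero_nat Real.pi)).const_mul _
  rw [Real.sinc_zero, mul_one] at h1
  refine h1.congr' ?_
  filter_upwards [Filter.eventually_gt_atTop 0] with N hN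
  have : (N : ℝ) ≠ 0 := by positivity
  rw [Real.sinc_of_ne_zero (by positivity)]
  field_simp

section Contact

variable {K : Set Plane} {B : ℝ} {x : ℝ → Plane}

/-- Discrete form of 2A(K) = πB² - 2V(K, -K): the first term on the right is the area of the regular
2n-gon inscribed in the circle of radius `B`, and the last sum approximates -2V(K, -K). It follows
from `add_pi` by pairing each index with the one half a turn later. -/
lemma IsContactMap.sum_cross_grid (hx : IsContactMap K B x) (θ : ℝ) {n : ℕ} (hn : 0 < n) :
    ∑ j ∈ Finset.range (2 * n), cross (x (grid θ n j)) (x (grid θ n (j + 1))) =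
      n * B ^ 2 * Real.sin (Real.pi / n) + ∑ j ∈ Finset.range (2 * n),
        cross (x (grid θ n j)) (x (grid θ n (j + n + 1)) - x (grid θ n (j + n))) := by
  rw [sum_range_two_mul, sum_range_two_mul]
  have hc : n * B ^ 2 * Real.sin (Real.pi / n) =
      ∑ j ∈ Finset.range n, B ^ 2 * cross (dir (grid θ n j)) (dir (grid θ n (j + 1))) := by
    simp only [cross_dir, grid_succ, add_sub_cancel_left, Finset.sum_const, Finset.card_range,
      nsmul_eq_mul]
    ring
  rw [hc, ← Finset.sum_add_distrib]
  refine Finset.sum_congr rfl fun j _ => ?_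
  have e1 : j + n + 1 = j + 1 + n := by ring
  have e2 : j + n + n + 1 = j + 1 + n + n := by ring
  rw [e2, e1, grid_add_self θ hn (j + 1 + n), grid_add_self θ hn (j + n), grid_add_self θ hn (j + 1),
    grid_add_self θ hn j]
  simp only [hx.add_pi, dir_add_pi]
  simp only [cross, PiLp.sub_apply, PiLp.smul_apply, PiLp.neg_apply, smul_eq_mul]
  ring

lemma IsContactMap.polygon_le (hK : Convex ℝ K) (hKf : volume K ≠ ⊤) (hx : IsContactMap K B x)
    (θ : ℝ) {n : ℕ} (hn : 0 < n) :
    ∑ j ∈ Finset.range (2 * n), cross (x (grid θ n j)) (x (grid θ n (j + 1))) ≤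
      2 * volume.real K := by
  have h2 : grid θ n (2 * n) = grid θ n 0 + 2 * Real.pi := by
    have h0 := grid_add_self θ hn 0
    rw [zero_add] at h0
    rw [two_mul, grid_add_self θ hn, h0]
    ring
  have h := sum_cross_le_volume hK (fun j => x (grid θ n j)) (2 * n) (fun i => hx.mem _)
    (by simp only [h2]; exact hx.add_two_pi _) (fun i j hij hj => by
      refine hx.cross_nonneg (grid_mono θ n (Nat.zero_le i)) (grid_mono θ n hij) ?_
      rw [← h2]
      exact grid_mono θ n hj)
  have h' := (ENNReal.ofReal_le_iff_le_toReal (ENNReal.mul_ne_top (by simp) hKf)).1 h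
  rwa [ENNReal.toReal_mul, ENNReal.toReal_ofNat] at h'

/-- A chord between contact points, compared with the normals opposite to those of its ends. -/
lemma IsContactMap.inner_opposite_chord (hx : IsContactMap K B x) (α β : ℝ) :
    0 ≤ inner ℝ (dir α) (x (β + Real.pi) - x (α + Real.pi)) ∧
      inner ℝ (dir β) (x (β + Real.pi) - x (α + Real.pi)) ≤ 0 := by
  have h1 := hx.le (α + Real.pi) _ (hx.mem (β + Real.pi))
  have h2 := hx.le (β + Real.pi) _ (hx.mem (α + Real.pi))
  simp only [dir_add_pi, inner_neg_left] at h1 h2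
  rw [inner_sub_right, inner_sub_right]
  constructor <;> linarith

/-- Moving a contact point outward to a circumscribed vertex can only decrease its cross product
with the opposite chord. -/
lemma IsContactMap.circumscribed_le_of_grid (hK : Convex ℝ K) (hKf : volume K ≠ ⊤)
    (hx : IsContactMap K B x)
    (θ : ℝ) {n : ℕ} (hn : 2 ≤ n) (v : ℕ → Plane)
    (hv : ∀ j, ∀ k ∈ K, 0 ≤ inner ℝ (dir (grid θ n j)) (v j - k) ∧
      0 ≤ inner ℝ (dir (grid θ n (j + 1))) (v j - k)) :
    n * B ^ 2 * Real.sin (Real.pi / n) + ∑ j ∈ Finset.range (2 * n),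
        cross (v j) (x (grid θ n (j + n + 1)) - x (grid θ n (j + n))) ≤ 2 * volume.real K := by
  have hn0 : 0 < n := by omega
  refine le_trans ?_ (hx.polygon_le hK hKf θ hn0)
  rw [hx.sum_cross_grid θ hn0]
  gcongr with j _
  have hn1 : (2 : ℝ) ≤ n := by exact_mod_cast hn
  have hcr : 0 < cross (dir (grid θ n j)) (dir (grid θ n (j + 1))) := by
    rw [cross_dir, grid_succ, add_sub_cancel_left]
    exact Real.sin_pos_of_pos_of_lt_pi (by positivity)
      (div_lt_self Real.pi_pos (by linarith))
  have e : j + n + 1 = j + 1 + n := by ring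
  have h := cross_nonneg_of_inner hcr
    (hx.inner_opposite_chord (grid θ n j) (grid θ n (j + 1))).1
    (hx.inner_opposite_chord (grid θ n j) (grid θ n (j + 1))).2
    (hv j _ (hx.mem (grid θ n j))).1 (hv j _ (hx.mem (grid θ n j))).2
  rw [e, grid_add_self θ hn0, grid_add_self θ hn0]
  rw [cross_sub_right, cross_comm _ (v j), cross_comm _ (x (grid θ n j))] at h
  linarith

/-- The area of a set of constant width is at least `π B² / 2` minus the mixed area of the
opposite set with a circumscribed polygon. -/
theorem IsContactMap.circumscribed_le (hK : Convex ℝ K) (hKf : volume K ≠ ⊤)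
    (hx : IsContactMap K B x)
    (θ : ℝ) {n : ℕ} (hn : 2 ≤ n) (v : ℕ → Plane)
    (hv : ∀ j, ∀ k ∈ K, 0 ≤ inner ℝ (dir (grid θ n j)) (v j - k) ∧
      0 ≤ inner ℝ (dir (grid θ n (j + 1))) (v j - k)) :
    Real.pi * B ^ 2 + ∑ j ∈ Finset.range (2 * n),
        cross (v j) (x (grid θ n (j + n + 1)) - x (grid θ n (j + n))) ≤ 2 * volume.real K := by
  have hn0 : 0 < n := by omega
  have hn1 : (2 : ℝ) ≤ n := by exact_mod_cast hn
  have hpin : Real.pi / n < Real.pi := div_lt_self Real.pi_pos (by linarith)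
  have hpos : 0 < Real.pi / n := by have := Real.pi_pos; positivity
  have key : ∀ M : ℕ, 0 < M → ((n * M : ℕ) : ℝ) * Real.sin (Real.pi / (n * M : ℕ)) * B ^ 2 +
      ∑ j ∈ Finset.range (2 * n),
        cross (v j) (x (grid θ n (j + n + 1)) - x (grid θ n (j + n))) ≤ 2 * volume.real K := by
    intro M hM
    have hstep : 2 ≤ n * M := hn.trans (Nat.le_mul_of_pos_right n hM)
    have hle : ∀ i j : ℕ, i ≤ j * M → grid θ (n * M) i ≤ grid θ n j := by
      intro i j hij
      rw [← grid_mul θ n hM]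
      exact grid_mono _ _ hij
    have hge : ∀ i j : ℕ, j * M ≤ i → grid θ n j ≤ grid θ (n * M) i := by
      intro i j hij
      rw [← grid_mul θ n hM]
      exact grid_mono _ _ hij
    -- On the grid refined `M` times the coarse vertices are repeated. They remain beyond the
    -- intermediate tangent lines, since an intermediate normal is a nonnegative combination of the
    -- two coarse ones.
    have h := hx.circumscribed_le_of_grid hK hKf θ hstep (fun j => v (j / M)) (by
      intro j k hk
      have h1 : j / M * M ≤ j := Nat.div_mul_le_self j M
      have h2 : j + 1 ≤ (j / M + 1) * M := by
        have := Nat.lt_div_mul_add (a := j) hM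
        rw [add_mul, one_mul]
        omega
      have h3 := hv (j / M) k hk
      have h4 := grid_succ θ n (j / M)
      constructor
      · exact inner_dir_nonneg_of_mem_Icc (hge _ _ h1) (hle _ _ (by omega)) (by linarith)
          (by linarith) h3.1 h3.2
      · exact inner_dir_nonneg_of_mem_Icc (hge _ _ (by omega)) (hle _ _ h2) (by linarith)
          (by linarith) h3.1 h3.2)
    have hsum := sum_cross_div v (fun j => x (grid θ (n * M) (j + n * M))) hM (2 * n)
    have hY : ∀ k, x (grid θ (n * M) (k * M + n * M)) = x (grid θ n (k + n)) := by
      intro k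
      rw [← add_mul, grid_mul θ n hM]
    simp only [hY, add_right_comm _ 1 n] at hsum
    rw [← hsum]
    convert h using 2
    · ring
    · rw [mul_assoc]
      refine Finset.sum_congr rfl fun j _ => ?_
      rw [add_right_comm]
  have hlim : Filter.Tendsto (fun M : ℕ => ((n * M : ℕ) : ℝ) * Real.sin (Real.pi / (n * M : ℕ)) *
      B ^ 2 + ∑ j ∈ Finset.range (2 * n),
        cross (v j) (x (grid θ n (j + n + 1)) - x (grid θ n (j + n)))) Filter.atTop
      (nhds (Real.pi * B ^ 2 + ∑ j ∈ Finset.range (2 * n),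
        cross (v j) (x (grid θ n (j + n + 1)) - x (grid θ n (j + n))))) :=
    ((tendsto_mul_sin_pi_div.comp
      (Filter.tendsto_id.const_mul_atTop' hn0)).mul_const _).add_const _
  refine le_of_tendsto hlim ?_
  filter_upwards [Filter.eventually_gt_atTop 0] with M hM using key M hM

end Contact

/-! ### The circumscribed regular hexagon -/

lemma inner_dir_dir (α β : ℝ) : inner ℝ (dir α) (dir β) = Real.cos (β - α) := by
  rw [inner_eq]
  simp only [dir_zero_coord, dir_one_coord, Real.cos_sub]
  ring

/-- Because 2 sin(π/6) = 1, the difference of the two directions is `dir α` turned by -π/2: in a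
regular hexagon the side equals the circumradius. -/
lemma cross_sub_dir (α : ℝ) (w : Plane) :
    cross (dir (α - Real.pi / 6) - dir (α + Real.pi / 6)) w = inner ℝ (dir α) w := by
  rw [inner_eq]
  simp only [cross, PiLp.sub_apply, dir_zero_coord, dir_one_coord, Real.cos_sub, Real.cos_add,
    Real.sin_sub, Real.sin_add, Real.sin_pi_div_six]
  ring

section Contact

variable {K : Set Plane} {B : ℝ} {x : ℝ → Plane}

lemma IsContactMap.inner_add_pi (hx : IsContactMap K B x) (θ : ℝ) :
    inner ℝ (dir (θ + Real.pi)) (x (θ + Real.pi)) = B - inner ℝ (dir θ) (x θ) := by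
  rw [hx.add_pi, dir_add_pi, inner_neg_left, inner_sub_right, real_inner_smul_right,
    real_inner_self_eq_norm_sq, norm_dir]
  ring

/-- No continuity of `x` is needed: comparing `x α` with the tangent line at `β` bounds the
difference of support values by ‖dir α - dir β‖ times a bound for `K`. -/
lemma IsContactMap.continuous_support (hK : IsCompact K) (hx : IsContactMap K B x) :
    Continuous fun θ => inner ℝ (dir θ) (x θ) := by
  obtain ⟨C, hC⟩ := hK.isBounded.exists_norm_le
  have key : ∀ α β, inner ℝ (dir α) (x α) - inner ℝ (dir β) (x β) ≤ ‖dir α - dir β‖ * C := by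
    intro α β
    have h1 := hx.le β _ (hx.mem α)
    have h2 := real_inner_le_norm (dir α - dir β) (x α)
    have h3 := mul_le_mul_of_nonneg_left (hC _ (hx.mem α)) (norm_nonneg (dir α - dir β))
    rw [inner_sub_left] at h2
    linarith
  rw [continuous_iff_continuousAt]
  intro β
  rw [ContinuousAt, tendsto_iff_dist_tendsto_zero]
  have hlim : Filter.Tendsto (fun α => ‖dir α - dir β‖ * C) (nhds β) (nhds 0) := by
    have : Continuous fun α => ‖dir α - dir β‖ * C := by
      have := continuous_dir
      fun_prop
    simpa using this.tendsto β
  refine squeeze_zero (fun _ => dist_nonneg) (fun α => ?_) hlim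
  rw [Real.dist_eq, abs_le]
  constructor
  · have := key β α
    rw [norm_sub_rev] at this
    linarith
  · exact key α β

/-- Some regular hexagon is circumscribed about a set of constant width. -/
lemma IsContactMap.exists_hexagon (hK : IsCompact K) (hx : IsContactMap K B x) :
    ∃ θ : ℝ, ∃ z : Plane, ∀ i : ℕ, inner ℝ (dir (grid θ 3 i)) z =
      inner ℝ (dir (grid θ 3 i)) (x (grid θ 3 i)) - B / 2 := by
  set p : ℝ → ℝ := fun θ => inner ℝ (dir θ) (x θ) with hp
  have hpc : Continuous p := hx.continuous_support hK
  have hpπ : ∀ θ, p (θ + Real.pi) = B - p θ := hx.inner_add_pi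
  -- The middle one of the three normals is the sum of the other two, so `f θ = 0` says exactly that
  -- the midlines of the three strips are concurrent. A turn by π/3 changes the sign of `f`.
  set f : ℝ → ℝ := fun θ => p θ - p (θ + Real.pi / 3) + p (θ + 2 * (Real.pi / 3)) - B / 2 with hf
  have hfc : Continuous f := by fun_prop
  have hneg : f (0 + Real.pi / 3) = -f 0 := by
    have e1 : (0 : ℝ) + Real.pi / 3 + Real.pi / 3 = 0 + 2 * (Real.pi / 3) := by ring
    have e2 : (0 : ℝ) + Real.pi / 3 + 2 * (Real.pi / 3) = 0 + Real.pi := by ring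
    simp only [hf, e1, e2, hpπ]
    ring
  obtain ⟨θ, hθ⟩ : (0 : ℝ) ∈ Set.range f := by
    rcases le_total (f 0) 0 with h | h
    · exact mem_range_of_exists_le_of_exists_ge hfc ⟨_, h⟩ ⟨0 + Real.pi / 3, by linarith⟩
    · exact mem_range_of_exists_le_of_exists_ge hfc ⟨0 + Real.pi / 3, by linarith⟩ ⟨_, h⟩
  have hcr : cross (dir θ) (dir (θ + Real.pi / 3)) ≠ 0 := by
    rw [cross_dir, add_sub_cancel_left, Real.sin_pi_div_three]
    positivity
  obtain ⟨z, hz0, hz1⟩ := exists_inner_eq hcr (p θ - B / 2) (p (θ + Real.pi / 3) - B / 2)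
  have hz2 : inner ℝ (dir (θ + 2 * (Real.pi / 3))) z = p (θ + 2 * (Real.pi / 3)) - B / 2 := by
    have h := sin_mul_inner_dir θ (θ + Real.pi / 3) (θ + 2 * (Real.pi / 3)) z
    have e1 : θ + 2 * (Real.pi / 3) - θ = Real.pi - Real.pi / 3 := by ring
    have e2 : θ + 2 * (Real.pi / 3) - (θ + Real.pi / 3) = Real.pi / 3 := by ring
    rw [e1, e2, add_sub_cancel_left, Real.sin_pi_sub, Real.sin_pi_div_three] at h
    have h3 : (0 : ℝ) < √3 / 2 := by positivity
    have h' : inner ℝ (dir (θ + Real.pi / 3)) z =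
        inner ℝ (dir θ) z + inner ℝ (dir (θ + 2 * (Real.pi / 3))) z := by
      apply mul_left_cancel₀ h3.ne'
      linarith
    simp only [hf] at hθ
    linarith
  refine ⟨θ, z, fun i => ?_⟩
  induction i using Nat.strong_induction_on with
  | _ i ih =>
    match i with
    | 0 => simpa [grid] using hz0
    | 1 => simpa [grid] using hz1
    | 2 => simpa [grid] using hz2
    | i + 3 =>
      have h := ih i (by omega)
      rw [grid_add_self θ (by norm_num), hx.inner_add_pi, dir_add_pi, inner_neg_left, h]
      ring

/-- The vertices of the regular hexagon of width `B` with center `z` and side normals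
`dir (grid θ 3 i)`. -/
noncomputable def hexVertex (B θ : ℝ) (z : Plane) (i : ℕ) : Plane :=
  z + (B / √3) • dir (grid θ 3 i + Real.pi / 6)

lemma inner_dir_hexVertex_left (B θ : ℝ) (z : Plane) (i : ℕ) :
    inner ℝ (dir (grid θ 3 i)) (hexVertex B θ z i) = inner ℝ (dir (grid θ 3 i)) z + B / 2 := by
  rw [hexVertex, inner_add_right, real_inner_smul_right, inner_dir_dir, add_sub_cancel_left,
    Real.cos_pi_div_six]
  field_simp

lemma inner_dir_hexVertex_right (B θ : ℝ) (z : Plane) (i : ℕ) :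
    inner ℝ (dir (grid θ 3 (i + 1))) (hexVertex B θ z i) =
      inner ℝ (dir (grid θ 3 (i + 1))) z + B / 2 := by
  rw [hexVertex, inner_add_right, real_inner_smul_right, inner_dir_dir, grid_succ]
  have : grid θ 3 i + Real.pi / 6 - (grid θ 3 i + Real.pi / (3 : ℕ)) = -(Real.pi / 6) := by
    push_cast; ring
  rw [this, Real.cos_neg, Real.cos_pi_div_six]
  field_simp

lemma hexVertex_add_six (B θ : ℝ) (z : Plane) (i : ℕ) :
    hexVertex B θ z (i + 6) = hexVertex B θ z i := by
  have : grid θ 3 (i + 6) + Real.pi / 6 = grid θ 3 i + Real.pi / 6 + 2 * Real.pi := by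
    simp only [grid]; push_cast; ring
  rw [hexVertex, hexVertex, this, dir_add_two_pi]

lemma hexVertex_sub_succ (B θ : ℝ) (z : Plane) (i : ℕ) (w : Plane) :
    cross (hexVertex B θ z i - hexVertex B θ z (i + 1)) w =
      B / √3 * inner ℝ (dir (grid θ 3 (i + 1))) w := by
  have e : grid θ 3 i + Real.pi / 6 = grid θ 3 (i + 1) - Real.pi / 6 := by
    rw [grid_succ]; push_cast; ring
  rw [hexVertex, hexVertex, add_sub_add_left_eq_sub, ← smul_sub, cross_smul_left, e,
    cross_sub_dir]

/-- Summation by parts turns this into side length times support values of `K`; opposite sides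
contribute -B together, and three such pairs with side B/√3 give -√3 B². -/
lemma IsContactMap.sum_hexVertex (hx : IsContactMap K B x) (θ : ℝ) (z : Plane) :
    ∑ i ∈ Finset.range (2 * 3), cross (hexVertex B θ z i)
      (x (grid θ 3 (i + 3 + 1)) - x (grid θ 3 (i + 3))) = -(√3 * B ^ 2) := by
  set v := hexVertex B θ z with hv
  have h1 : ∀ i, cross (v i) (x (grid θ 3 (i + 3 + 1)) - x (grid θ 3 (i + 3))) =
      B / √3 * inner ℝ (dir (grid θ 3 (i + 1))) (x (grid θ 3 (i + 1 + 3))) +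
        (cross (v (i + 1)) (x (grid θ 3 (i + 1 + 3))) - cross (v i) (x (grid θ 3 (i + 3)))) := by
    intro i
    rw [← hexVertex_sub_succ B θ z, ← hv, cross_sub_left, cross_sub_right, add_right_comm i 3 1]
    ring
  have hper : x (grid θ 3 (2 * 3 + 3)) = x (grid θ 3 (0 + 3)) := by
    have : grid θ 3 (2 * 3 + 3) = grid θ 3 (0 + 3) + 2 * Real.pi := by
      simp only [grid]; push_cast; ring
    rw [this, hx.add_two_pi]
  have hvper : v (2 * 3) = v 0 := hexVertex_add_six B θ z 0
  rw [Finset.sum_congr rfl fun i _ => h1 i, Finset.sum_add_distrib,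
    Finset.sum_range_sub (fun i => cross (v i) (x (grid θ 3 (i + 3)))), hper, hvper, sub_self,
    add_zero, ← Finset.mul_sum, sum_range_two_mul]
  have h2 : ∀ i : ℕ, inner ℝ (dir (grid θ 3 (i + 1))) (x (grid θ 3 (i + 1 + 3))) +
      inner ℝ (dir (grid θ 3 (i + 3 + 1))) (x (grid θ 3 (i + 3 + 1 + 3))) = -B := by
    intro i
    rw [add_right_comm i 3 1, grid_add_self θ (by norm_num) (i + 1 + 3),
      grid_add_self θ (by norm_num) (i + 1)]
    simp only [hx.add_pi, dir_add_pi]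
    simp only [inner_neg_left, inner_sub_right, real_inner_smul_right, smul_neg, inner_neg_right,
      real_inner_self_eq_norm_sq, norm_dir]
    ring
  rw [Finset.sum_congr rfl fun i _ => h2 i, Finset.sum_const, Finset.card_range]
  have h4 : √3 ≠ (0 : ℝ) := by positivity
  simp only [nsmul_eq_mul]
  push_cast
  field_simp
  rw [Real.sq_sqrt (by norm_num)]

/-- The point `z` is the center of the circumscribed regular hexagon at `θ`. -/
def IsHexagonCenter (B : ℝ) (x : ℝ → Plane) (θ : ℝ) (z : Plane) : Prop :=
  ∀ i : ℕ, inner ℝ (dir (grid θ 3 i)) z = inner ℝ (dir (grid θ 3 i)) (x (grid θ 3 i)) - B / 2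

variable {θ : ℝ} {z : Plane}

lemma IsHexagonCenter.inner_left (hz : IsHexagonCenter B x θ z) (i : ℕ) :
    inner ℝ (dir (grid θ 3 i)) (hexVertex B θ z i) =
      inner ℝ (dir (grid θ 3 i)) (x (grid θ 3 i)) := by
  rw [inner_dir_hexVertex_left, hz i]; ring

lemma IsHexagonCenter.inner_right (hz : IsHexagonCenter B x θ z) (i : ℕ) :
    inner ℝ (dir (grid θ 3 (i + 1))) (hexVertex B θ z i) =
      inner ℝ (dir (grid θ 3 (i + 1))) (x (grid θ 3 (i + 1))) := by
  rw [inner_dir_hexVertex_right, hz (i + 1)]; ring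

lemma IsHexagonCenter.circumscribed (hx : IsContactMap K B x) (hz : IsHexagonCenter B x θ z)
    (i : ℕ) (k : Plane) (hk : k ∈ K) :
    0 ≤ inner ℝ (dir (grid θ 3 i)) (hexVertex B θ z i - k) ∧
      0 ≤ inner ℝ (dir (grid θ 3 (i + 1))) (hexVertex B θ z i - k) := by
  rw [inner_sub_right, inner_sub_right, hz.inner_left, hz.inner_right]
  exact ⟨sub_nonneg.2 (hx.le _ k hk), sub_nonneg.2 (hx.le _ k hk)⟩

theorem IsContactMap.le_volume (hK : IsConvexRegion K) (hx : IsContactMap K B x) :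
    (Real.pi - √3) * B ^ 2 ≤ 2 * volume.real K := by
  obtain ⟨θ, z, hz⟩ := hx.exists_hexagon hK.isCompact
  have h := hx.circumscribed_le hK.convex hK.isCompact.measure_ne_top θ (n := 3) (by norm_num)
    (hexVertex B θ z) (IsHexagonCenter.circumscribed hx hz)
  rw [hx.sum_hexVertex] at h
  linarith

/-! ### Sets of minimal area -/

lemma cross_dir_grid_pos (θ : ℝ) {n : ℕ} (hn : 2 ≤ n) (j : ℕ) :
    0 < cross (dir (grid θ n j)) (dir (grid θ n (j + 1))) := by
  have hn1 : (2 : ℝ) ≤ n := by exact_mod_cast hn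
  rw [cross_dir, grid_succ, add_sub_cancel_left]
  exact Real.sin_pos_of_pos_of_lt_pi (by have := Real.pi_pos; positivity)
    (div_lt_self Real.pi_pos (by linarith))

/-- The tangent line of an intermediate direction misses a hexagon vertex outside of `K`. -/
lemma IsHexagonCenter.inner_lt (hx : IsContactMap K B x) (hz : IsHexagonCenter B x θ z) {i : ℕ}
    (hi : hexVertex B θ z i ∉ K) {φ : ℝ} (h1 : grid θ 3 i < φ) (h2 : φ < grid θ 3 (i + 1)) :
    inner ℝ (dir φ) (x φ) < inner ℝ (dir φ) (hexVertex B θ z i) := by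
  by_contra! hle
  set w := hexVertex B θ z i - x φ with hw
  have hwφ : inner ℝ (dir φ) w ≤ 0 := by rw [hw, inner_sub_right]; linarith
  obtain ⟨ha, hb⟩ := IsHexagonCenter.circumscribed hx hz i _ (hx.mem φ)
  rw [← hw] at ha hb
  have hg := grid_succ θ 3 i
  push_cast at hg
  have hpi := Real.pi_pos
  have hs : 0 < Real.sin (grid θ 3 (i + 1) - grid θ 3 i) :=
    Real.sin_pos_of_pos_of_lt_pi (by linarith) (by linarith)
  have hs1 : 0 < Real.sin (grid θ 3 (i + 1) - φ) :=
    Real.sin_pos_of_pos_of_lt_pi (by linarith) (by linarith)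
  have hs2 : 0 < Real.sin (φ - grid θ 3 i) :=
    Real.sin_pos_of_pos_of_lt_pi (by linarith) (by linarith)
  have h := sin_mul_inner_dir (grid θ 3 i) φ (grid θ 3 (i + 1)) w
  have h3 := mul_nonneg hs1.le ha
  have h4 := mul_nonneg hs2.le hb
  have h5 := mul_nonpos_of_nonneg_of_nonpos hs.le hwφ
  have h6 : inner ℝ (dir (grid θ 3 i)) w = 0 :=
    (mul_eq_zero.1 (by linarith : Real.sin (grid θ 3 (i + 1) - φ) * _ = 0)).resolve_left hs1.ne'
  have h7 : inner ℝ (dir (grid θ 3 (i + 1))) w = 0 :=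
    (mul_eq_zero.1 (by linarith : Real.sin (φ - grid θ 3 i) * _ = 0)).resolve_left hs2.ne'
  have h8 := eq_zero_of_inner (cross_dir_grid_pos θ (n := 3) (by norm_num) i).ne' h6 h7
  rw [hw, sub_eq_zero] at h8
  exact hi (h8 ▸ hx.mem φ)

/-- The hexagon is compared with the circumscribed polygon of 6N sides. At minimal area the latter
gains nothing, while cutting off a vertex outside `K` gains strictly unless the opposite chord
vanishes. The bounds on `l` keep both normals of the chord strictly between two hexagon normals. -/
lemma IsHexagonCenter.contact_eq_of_minimal (hK : IsConvexRegion K) (hx : IsContactMap K B x)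
    (hz : IsHexagonCenter B x θ z) (hmin : 2 * volume.real K ≤ (Real.pi - √3) * B ^ 2) {N : ℕ}
    {i l : ℕ} (hi6 : i < 6) (hi : hexVertex B θ z i ∉ K) (hl : 0 < l) (hlN : l + 1 < N) :
    x (grid θ (3 * N) (i * N + l + 1) + Real.pi) = x (grid θ (3 * N) (i * N + l) + Real.pi) := by
  have hN : 0 < N := by omega
  set n := 3 * N with hn
  have hn2 : 2 ≤ n := by omega
  have hcr := cross_dir_grid_pos θ hn2
  choose v hv1 hv2 using fun j => exists_inner_eq (hcr j).ne'
    (inner ℝ (dir (grid θ n j)) (x (grid θ n j)))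
    (inner ℝ (dir (grid θ n (j + 1))) (x (grid θ n (j + 1))))
  have hlow := hx.circumscribed_le hK.convex hK.isCompact.measure_ne_top θ hn2 v (by
    intro j k hk
    rw [inner_sub_right, inner_sub_right, hv1, hv2]
    exact ⟨sub_nonneg.2 (hx.le _ k hk), sub_nonneg.2 (hx.le _ k hk)⟩)
  set Z : ℕ → Plane := fun j => x (grid θ n (j + n + 1)) - x (grid θ n (j + n)) with hZ
  have hZeq : ∀ j, Z j = x (grid θ n (j + 1) + Real.pi) - x (grid θ n j + Real.pi) := by
    intro j
    simp only [hZ, add_right_comm j n 1, grid_add_self θ (by omega : 0 < n)]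
  have hhex : ∑ j ∈ Finset.range (2 * n), cross (hexVertex B θ z (j / N)) (Z j) =
      -(√3 * B ^ 2) := by
    rw [← hx.sum_hexVertex θ z]
    have h := sum_cross_div (hexVertex B θ z) (fun j => x (grid θ n (j + n))) hN (2 * 3)
    have e1 : 2 * n = 2 * 3 * N := by omega
    have e2 : ∀ k, grid θ n (k * N + n) = grid θ 3 (k + 3) := by
      intro k
      rw [← grid_mul θ 3 hN, add_mul]
    simp only [e2] at h
    rw [e1]
    simp only [hZ, add_right_comm _ n 1, add_right_comm _ 3 1]
    exact h
  have hge : ∀ a b : ℕ, a * N ≤ b → grid θ 3 a ≤ grid θ n b := by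
    intro a b hab
    rw [← grid_mul θ 3 hN]
    exact grid_mono _ _ hab
  have hle : ∀ a b : ℕ, b ≤ a * N → grid θ n b ≤ grid θ 3 a := by
    intro a b hab
    rw [← grid_mul θ 3 hN]
    exact grid_mono _ _ hab
  have hstep : ∀ a, grid θ 3 (a + 1) = grid θ 3 a + Real.pi / 3 := by
    intro a
    have := grid_succ θ 3 a
    push_cast at this
    exact this
  have hpi := Real.pi_pos
  have hZ1 : ∀ j, 0 ≤ inner ℝ (dir (grid θ n j)) (Z j) := by
    intro j
    rw [hZeq]
    exact (hx.inner_opposite_chord _ _).1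
  have hZ2 : ∀ j, inner ℝ (dir (grid θ n (j + 1))) (Z j) ≤ 0 := by
    intro j
    rw [hZeq]
    exact (hx.inner_opposite_chord _ _).2
  -- The hexagon vertex lies beyond both tangent lines that meet in `v j`, so each chord contributes
  -- a nonnegative loss.
  have hnonneg : ∀ j, 0 ≤ cross (Z j) (hexVertex B θ z (j / N) - v j) := by
    intro j
    have h1 : j / N * N ≤ j := Nat.div_mul_le_self j N
    have h2 : j + 1 ≤ (j / N + 1) * N := by
      have := Nat.lt_div_mul_add (a := j) hN
      rw [add_mul, one_mul]
      omega
    refine cross_nonneg_of_inner (hcr j) (hZ1 j) (hZ2 j) ?_ ?_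
    · have h3 := IsHexagonCenter.circumscribed hx hz (j / N) _ (hx.mem (grid θ n j))
      have h4 := inner_dir_nonneg_of_mem_Icc (hge _ _ h1) (hle _ _ (by omega))
        (by linarith [hstep (j / N)]) (by linarith [hstep (j / N)]) h3.1 h3.2
      rwa [inner_sub_right, ← hv1, ← inner_sub_right] at h4
    · have h3 := IsHexagonCenter.circumscribed hx hz (j / N) _ (hx.mem (grid θ n (j + 1)))
      have h4 := inner_dir_nonneg_of_mem_Icc (hge _ (j + 1) (by omega)) (hle _ _ h2)
        (by linarith [hstep (j / N)]) (by linarith [hstep (j / N)]) h3.1 h3.2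
      rwa [inner_sub_right, ← hv2, ← inner_sub_right] at h4
  -- The lower bound from the fine polygon and the assumed upper bound on the area squeeze the total
  -- loss to zero.
  have hsum : ∑ j ∈ Finset.range (2 * n), cross (Z j) (hexVertex B θ z (j / N) - v j) = 0 := by
    refine le_antisymm ?_ (Finset.sum_nonneg fun j _ => hnonneg j)
    have h1 : ∀ j, cross (Z j) (hexVertex B θ z (j / N) - v j) =
        cross (v j) (Z j) - cross (hexVertex B θ z (j / N)) (Z j) := by
      intro j
      rw [cross_sub_right, cross_comm (Z j), cross_comm (Z j)]
      ring
    rw [Finset.sum_congr rfl fun j _ => h1 j, Finset.sum_sub_distrib, hhex]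
    linarith
  set j := i * N + l with hj
  have hjN : j / N = i := by
    rw [hj, mul_comm, Nat.mul_add_div hN, Nat.div_eq_of_lt (by omega), add_zero]
  have hi5 : i * N ≤ 5 * N := Nat.mul_le_mul_right N (by omega)
  have hjr : j ∈ Finset.range (2 * n) := by
    rw [Finset.mem_range]
    omega
  have hzero := (Finset.sum_eq_zero_iff_of_nonneg fun j _ => hnonneg j).1 hsum j hjr
  rw [hjN] at hzero
  have hlo : ∀ b, i * N < b → grid θ 3 i < grid θ n b := by
    intro b hb
    refine (hge i (b - 1) (by omega)).trans_lt ?_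
    have := grid_succ θ n (b - 1)
    rw [Nat.sub_add_cancel (by omega)] at this
    have : 0 < Real.pi / n := by positivity
    linarith
  have hhi : ∀ b, b < (i + 1) * N → grid θ n b < grid θ 3 (i + 1) := by
    intro b hb
    refine lt_of_lt_of_le ?_ (hle (i + 1) (b + 1) (by omega))
    have := grid_succ θ n b
    have : 0 < Real.pi / n := by positivity
    linarith
  have hb1 : j + 1 < (i + 1) * N := by rw [add_mul, one_mul]; omega
  have hw1 : 0 < inner ℝ (dir (grid θ n j)) (hexVertex B θ z i - v j) := by
    rw [inner_sub_right, hv1, sub_pos]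
    exact IsHexagonCenter.inner_lt hx hz hi (hlo j (by omega)) (hhi j (by omega))
  have hw2 : 0 < inner ℝ (dir (grid θ n (j + 1))) (hexVertex B θ z i - v j) := by
    rw [inner_sub_right, hv2, sub_pos]
    exact IsHexagonCenter.inner_lt hx hz hi (hlo _ (by omega)) (hhi _ hb1)
  have hbc := cross_mul_cross (dir (grid θ n j)) (dir (grid θ n (j + 1))) (Z j)
    (hexVertex B θ z i - v j)
  rw [hzero, mul_zero] at hbc
  have k1 := mul_nonneg (hZ1 j) hw2.le
  have k2 := mul_nonneg (neg_nonneg.2 (hZ2 j)) hw1.le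
  have k3 : inner ℝ (dir (grid θ n j)) (Z j) = 0 :=
    (mul_eq_zero.1 (by linarith : _ * inner ℝ (dir (grid θ n (j + 1)))
      (hexVertex B θ z i - v j) = 0)).resolve_right hw2.ne'
  have k4 : inner ℝ (dir (grid θ n (j + 1))) (Z j) = 0 :=
    (mul_eq_zero.1 (by linarith : _ * inner ℝ (dir (grid θ n j))
      (hexVertex B θ z i - v j) = 0)).resolve_right hw1.ne'
  have k5 := eq_zero_of_inner (hcr j).ne' k3 k4
  rwa [hZeq, sub_eq_zero] at k5

/-- A set of minimal area contains one of any two opposite vertices of its circumscribed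
hexagon. -/
lemma IsHexagonCenter.mem_or_mem (hK : IsConvexRegion K) (hx : IsContactMap K B x)
    (hz : IsHexagonCenter B x θ z) (hmin : 2 * volume.real K ≤ (Real.pi - √3) * B ^ 2)
    {i : ℕ} (hi6 : i < 6) : hexVertex B θ z i ∈ K ∨ hexVertex B θ z (i + 3) ∈ K := by
  by_contra! hcon
  obtain ⟨hi, hi3⟩ := hcon
  apply hi3
  have hconst : ∀ N l, 0 < l → l < N → x (grid θ (3 * N) (i * N + l) + Real.pi) =
      x (grid θ (3 * N) (i * N + 1) + Real.pi) := by
    intro N l hl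
    induction l, hl using Nat.le_induction with
    | base => intro _; rfl
    | succ l hl ih =>
      intro hlN
      rw [← ih (by omega), ← hz.contact_eq_of_minimal hK hx hmin hi6 hi hl hlN, add_assoc]
  -- An even number of subdivisions makes the middle angle a grid point for every `M`, so the
  -- constant value is the same `y` on all these grids.
  have hgrid : ∀ M l : ℕ, 0 < M → grid θ (3 * (2 * M)) (i * (2 * M) + l) =
      grid θ 3 i + l * (Real.pi / 6 / M) := by
    intro M l hM
    have : (M : ℝ) ≠ 0 := by positivity
    simp only [grid]
    push_cast
    field_simp
    ring
  set y := x (grid θ 3 i + Real.pi / 6 + Real.pi) with hy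
  have hmid : ∀ M l : ℕ, 0 < M → 0 < l → l < 2 * M →
      x (grid θ 3 i + l * (Real.pi / 6 / M) + Real.pi) = y := by
    intro M l hM hl hlM
    have h1 := hconst (2 * M) l hl hlM
    have h2 := hconst (2 * M) M hM (by omega)
    rw [hgrid M _ hM] at h1
    rw [hgrid M _ hM] at h2
    have hM' : (M : ℝ) ≠ 0 := by positivity
    rw [h1, ← h2, hy, mul_div_cancel₀ _ hM']
  have hlim0 : Filter.Tendsto (fun M : ℕ => Real.pi / 6 / M) Filter.atTop (nhds 0) :=
    tendsto_const_div_atTop_nhds_zero_nat _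
  have hpc := hx.continuous_support hK.isCompact
  have hyc : Continuous fun φ => inner ℝ (dir φ) y := by
    have := continuous_dir
    fun_prop
  -- By continuity of the support function, `y` also lies on the tangent lines at both ends of the
  -- open arc. These two lines meet in the opposite hexagon vertex.
  have hlimit : ∀ (g : ℝ → ℝ), Continuous g →
      (∀ M : ℕ, 0 < M → x (g (Real.pi / 6 / M)) = y) →
      inner ℝ (dir (g 0)) (x (g 0)) = inner ℝ (dir (g 0)) y := by
    intro g hg h
    have t1 := ((hpc.comp hg).tendsto 0).comp hlim0
    have t2 := ((hyc.comp hg).tendsto 0).comp hlim0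
    refine tendsto_nhds_unique t1 (t2.congr' ?_)
    filter_upwards [Filter.eventually_gt_atTop 0] with M hM
    simp only [Function.comp_apply]
    rw [h M hM]
  have e1 : inner ℝ (dir (grid θ 3 (i + 3))) (x (grid θ 3 (i + 3))) =
      inner ℝ (dir (grid θ 3 (i + 3))) y := by
    have h := hlimit (fun t => grid θ 3 i + t + Real.pi) (by fun_prop) (by
      intro M hM
      simpa using hmid M 1 hM one_pos (by omega))
    simpa [grid_add_self θ (by norm_num : 0 < 3)] using h
  have e2 : inner ℝ (dir (grid θ 3 (i + 3 + 1))) (x (grid θ 3 (i + 3 + 1))) =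
      inner ℝ (dir (grid θ 3 (i + 3 + 1))) y := by
    have h := hlimit (fun t => grid θ 3 (i + 1) - t + Real.pi) (by fun_prop) (by
      intro M hM
      have hM' : (M : ℝ) ≠ 0 := by positivity
      rw [← hmid M (2 * M - 1) hM (by omega) (by omega), grid_succ]
      congr 1
      rw [Nat.cast_sub (by omega)]
      push_cast
      field_simp
      ring)
    simpa [add_right_comm i 3 1, grid_add_self θ (by norm_num : 0 < 3)] using h
  have hyv : hexVertex B θ z (i + 3) - y = 0 := by
    refine eq_zero_of_inner (cross_dir_grid_pos θ (n := 3) (by norm_num) (i + 3)).ne' ?_ ?_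
    · rw [inner_sub_right, hz.inner_left, e1, sub_self]
    · rw [inner_sub_right, hz.inner_right, e2, sub_self]
  rw [sub_eq_zero.1 hyv]
  exact hx.mem _

end Contact

/-! ### Reuleaux triangles -/

/-- The intersection of the disks of radius `B` centered at three points. -/
def reuleaux (B : ℝ) (p q r : Plane) : Set Plane :=
  Metric.closedBall p B ∩ Metric.closedBall q B ∩ Metric.closedBall r B

/-- The points are the vertices of an equilateral triangle of side `B`. -/
structure IsEquilateral (B : ℝ) (p q r : Plane) : Prop where
  dist_pq : dist p q = B
  dist_qr : dist q r = B
  dist_rp : dist r p = B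

section Reuleaux

variable {B : ℝ} {p q r : Plane}

lemma IsEquilateral.rotate (h : IsEquilateral B p q r) : IsEquilateral B q r p :=
  ⟨h.dist_qr, h.dist_rp, h.dist_pq⟩

lemma IsEquilateral.swap (h : IsEquilateral B p q r) : IsEquilateral B p r q :=
  ⟨by rw [dist_comm]; exact h.dist_rp, by rw [dist_comm]; exact h.dist_qr,
    by rw [dist_comm]; exact h.dist_pq⟩

lemma reuleaux_rotate (B : ℝ) (p q r : Plane) : reuleaux B q r p = reuleaux B p q r := by
  unfold reuleaux
  ext x
  simp only [Set.mem_inter_iff]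
  tauto

lemma reuleaux_swap (B : ℝ) (p q r : Plane) : reuleaux B p r q = reuleaux B p q r := by
  unfold reuleaux
  ext x
  simp only [Set.mem_inter_iff]
  tauto

lemma mem_reuleaux {x : Plane} :
    x ∈ reuleaux B p q r ↔ ‖x - p‖ ≤ B ∧ ‖x - q‖ ≤ B ∧ ‖x - r‖ ≤ B := by
  simp only [reuleaux, Set.mem_inter_iff, Metric.mem_closedBall, dist_eq_norm, and_assoc]

lemma IsEquilateral.norm_left (h : IsEquilateral B p q r) : ‖q - p‖ = B := by
  rw [← dist_eq_norm, dist_comm]; exact h.dist_pq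

lemma IsEquilateral.norm_right (h : IsEquilateral B p q r) : ‖r - p‖ = B := by
  rw [← dist_eq_norm]; exact h.dist_rp

lemma IsEquilateral.inner_eq (h : IsEquilateral B p q r) :
    inner ℝ (q - p) (r - p) = B ^ 2 / 2 := by
  have h1 := norm_sub_sq_real (q - p) (r - p)
  rw [sub_sub_sub_cancel_right, ← dist_eq_norm, h.dist_qr, h.norm_left, h.norm_right] at h1
  linarith

lemma IsEquilateral.mem_reuleaux (hB : 0 ≤ B) (h : IsEquilateral B p q r) :
    p ∈ reuleaux B p q r := by
  refine ⟨⟨Metric.mem_closedBall_self hB, ?_⟩, ?_⟩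
  · exact h.dist_pq.le
  · rw [Metric.mem_closedBall, dist_comm]; exact h.dist_rp.le

lemma IsEquilateral.cross_sq (h : IsEquilateral B p q r) :
    cross (q - p) (r - p) ^ 2 = 3 / 4 * B ^ 4 := by
  have h1 := cross_mul_cross (q - p) (r - p) (q - p) (r - p)
  rw [real_inner_self_eq_norm_sq, real_inner_self_eq_norm_sq, h.norm_left, h.norm_right,
    real_inner_comm, h.inner_eq] at h1
  rw [sq, h1]
  ring

/-- Points of a disk lie in a half plane through any boundary point. -/
lemma inner_nonneg_of_norm_sub_le {x : Plane} (h : ‖q - p‖ = B) (hx : ‖x - q‖ ≤ B) :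
    0 ≤ inner ℝ (q - p) (x - p) := by
  have h1 := norm_sub_sq_real (x - p) (q - p)
  rw [sub_sub_sub_cancel_right, h, real_inner_comm] at h1
  have h2 : ‖x - q‖ ^ 2 ≤ B ^ 2 := by gcongr
  nlinarith [sq_nonneg ‖x - p‖]

/-- The set `T` has width `B` in the direction `u`. -/
def HasWidth (T : Set Plane) (B : ℝ) (u : Plane) : Prop :=
  ∃ m : ℝ, (∃ x ∈ T, inner ℝ u x = m) ∧ (∃ x ∈ T, inner ℝ u x = m + B) ∧
    ∀ y ∈ T, m ≤ inner ℝ u y ∧ inner ℝ u y ≤ m + B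

lemma HasWidth.of_neg {T : Set Plane} {u : Plane} (h : HasWidth T B (-u)) : HasWidth T B u := by
  obtain ⟨m, ⟨x, hx, hxm⟩, ⟨y, hy, hym⟩, hall⟩ := h
  simp only [inner_neg_left] at hxm hym hall
  exact ⟨-m - B, ⟨y, hy, by linarith⟩, ⟨x, hx, by linarith⟩, fun z hz =>
    ⟨by linarith [(hall z hz).2], by linarith [(hall z hz).1]⟩⟩

lemma hasConstantWidth_of_hasWidth {T : Set Plane} (hB : 0 ≤ B)
    (h : ∀ u : Plane, ‖u‖ = 1 → HasWidth T B u) : HasConstantWidth T B := by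
  intro u hu a b hab ha hb
  obtain ⟨m, ⟨x, hx, hxm⟩, ⟨y, hy, hym⟩, hall⟩ := h u hu
  have key : ∀ c, IsTangentLine T u c → c = m ∨ c = m + B := by
    rintro c ⟨⟨z, hz, rfl⟩, hc | hc⟩
    · exact Or.inr (le_antisymm (hall z hz).2 (hym ▸ hc y hy))
    · exact Or.inl (le_antisymm (hxm ▸ hc x hx) (hall z hz).1)
  rcases key a ha with rfl | rfl <;> rcases key b hb with rfl | rfl
  · exact absurd rfl hab
  · rw [abs_sub_comm, add_sub_cancel_left, abs_of_nonneg hB]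
  · rw [add_sub_cancel_left, abs_of_nonneg hB]
  · exact absurd rfl hab

/-- For `u` in the cone of the triangle at `p`, the lowest point is the vertex `p` and the highest
is `p + B • u` on the opposite arc. -/
lemma IsEquilateral.hasWidth_of_cone (hB : 0 < B) (h : IsEquilateral B p q r) {u : Plane}
    (hu : ‖u‖ = 1) {s t : ℝ} (hs : 0 ≤ s) (ht : 0 ≤ t) (hst : u = s • (q - p) + t • (r - p)) :
    HasWidth (reuleaux B p q r) B u := by
  have hab := h.inner_eq
  have ha2 : inner ℝ (q - p) (q - p) = B ^ 2 := by
    rw [real_inner_self_eq_norm_sq, h.norm_left]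
  have hb2 : inner ℝ (r - p) (r - p) = B ^ 2 := by
    rw [real_inner_self_eq_norm_sq, h.norm_right]
  have hua : inner ℝ u (q - p) = B ^ 2 * (s + t / 2) := by
    rw [hst, inner_add_left, real_inner_smul_left, real_inner_smul_left, ha2,
      real_inner_comm (q - p) (r - p), hab]
    ring
  have hub : inner ℝ u (r - p) = B ^ 2 * (t + s / 2) := by
    rw [hst, inner_add_left, real_inner_smul_left, real_inner_smul_left, hb2, hab]
    ring
  have huu : inner ℝ u u = 1 := by rw [real_inner_self_eq_norm_sq, hu, one_pow]
  have hone : (B * s) ^ 2 + (B * s) * (B * t) + (B * t) ^ 2 = 1 := by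
    have h1 : inner ℝ u u = s * inner ℝ u (q - p) + t * inner ℝ u (r - p) := by
      conv_lhs => rw [hst, inner_add_right, ← hst, real_inner_smul_right, real_inner_smul_right]
    rw [hua, hub, huu] at h1
    linarith
  have hBs : 0 ≤ B * s := by positivity
  have hBt : 0 ≤ B * t := by positivity
  have hu0 : inner ℝ u p + B = inner ℝ u (p + B • u) := by
    rw [inner_add_right, real_inner_smul_right, huu, mul_one]
  have far : ∀ (a : Plane), ‖a - p‖ = B → 1 / 2 * B ≤ inner ℝ u (a - p) →
      ‖p + B • u - a‖ ≤ B := by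
    intro a ha hua
    have h1 := norm_sub_sq_real (B • u) (a - p)
    have e : B • u - (a - p) = p + B • u - a := by abel
    rw [e, norm_smul, hu, mul_one, Real.norm_of_nonneg hB.le, real_inner_smul_left, ha] at h1
    nlinarith [norm_nonneg (p + B • u - a)]
  refine ⟨inner ℝ u p, ⟨p, h.mem_reuleaux hB.le, rfl⟩, ⟨p + B • u, ?_, hu0.symm⟩, ?_⟩
  · rw [BlaschkeLebesgue.mem_reuleaux]
    refine ⟨?_, far q h.norm_left ?_, far r h.norm_right ?_⟩
    · rw [add_sub_cancel_left, norm_smul, hu, mul_one, Real.norm_of_nonneg hB.le]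
    · rw [hua]
      -- By `hone` the square of the right side is 1 - (3/4)(B t)², and B t ≤ 1: the angle between
      -- `u` and the side is at most π/3.
      have : 1 / 2 ≤ B * s + B * t / 2 := by
        by_contra! hlt
        nlinarith
      nlinarith
    · rw [hub]
      have : 1 / 2 ≤ B * t + B * s / 2 := by
        by_contra! hlt
        nlinarith
      nlinarith
  · intro y hy
    rw [BlaschkeLebesgue.mem_reuleaux] at hy
    have h1 := inner_nonneg_of_norm_sub_le h.norm_left hy.2.1
    have h2 := inner_nonneg_of_norm_sub_le h.norm_right hy.2.2
    have h3 : inner ℝ u (y - p) = s * inner ℝ (q - p) (y - p) + t * inner ℝ (r - p) (y - p) := by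
      rw [hst, inner_add_left, real_inner_smul_left, real_inner_smul_left]
    have h4 : 0 ≤ inner ℝ u (y - p) := by rw [h3]; positivity
    have h5 := real_inner_le_norm u (y - p)
    rw [hu, one_mul] at h5
    rw [inner_sub_right] at h4 h5
    constructor <;> linarith [hy.1]

/-- The cones at the three vertices and their negatives cover all directions; here `u` is in the
cone at `q` or `-u` in the one at `r`. -/
lemma IsEquilateral.hasWidth_of_mixed (hB : 0 < B) (h : IsEquilateral B p q r) {u : Plane}
    (hu : ‖u‖ = 1) {s t : ℝ} (hs : s ≤ 0) (ht : 0 ≤ t) (hst : u = s • (q - p) + t • (r - p)) :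
    HasWidth (reuleaux B p q r) B u := by
  rcases le_total t (-s) with hle | hle
  · rw [← reuleaux_rotate]
    exact h.rotate.hasWidth_of_cone hB hu ht (by linarith : 0 ≤ -s - t) (by rw [hst]; module)
  · apply HasWidth.of_neg
    rw [← reuleaux_rotate, ← reuleaux_rotate]
    exact h.rotate.rotate.hasWidth_of_cone hB (by rw [norm_neg]; exact hu)
      (by linarith : 0 ≤ t + s) (by linarith : 0 ≤ -s) (by rw [hst]; module)

lemma IsEquilateral.hasConstantWidth (hB : 0 < B) (h : IsEquilateral B p q r) :
    HasConstantWidth (reuleaux B p q r) B := by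
  refine hasConstantWidth_of_hasWidth hB.le fun u hu => ?_
  have hD : cross (q - p) (r - p) ≠ 0 := by
    intro h0
    have h1 := h.cross_sq
    rw [h0] at h1
    have : 0 < B ^ 4 := by positivity
    linarith
  obtain ⟨s, t, hst⟩ : ∃ s t : ℝ, u = s • (q - p) + t • (r - p) := by
    refine ⟨(cross (q - p) (r - p))⁻¹ * cross u (r - p),
      (cross (q - p) (r - p))⁻¹ * cross (q - p) u, ?_⟩
    rw [mul_smul, mul_smul, ← smul_add, ← cross_smul_eq, smul_smul, inv_mul_cancel₀ hD, one_smul]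
  have hneg : -u = (-s) • (q - p) + (-t) • (r - p) := by rw [hst]; module
  have hu' : ‖-u‖ = 1 := by rw [norm_neg]; exact hu
  rcases le_total 0 s with hs | hs <;> rcases le_total 0 t with ht | ht
  · exact h.hasWidth_of_cone hB hu hs ht hst
  · exact (h.hasWidth_of_mixed hB hu' (neg_nonpos.2 hs) (neg_nonneg.2 ht) hneg).of_neg
  · exact h.hasWidth_of_mixed hB hu hs ht hst
  · exact (h.hasWidth_of_cone hB hu' (neg_nonneg.2 hs) (neg_nonneg.2 ht) hneg).of_neg

lemma IsEquilateral.center_mem_ball (hB : 0 < B) (h : IsEquilateral B p q r) :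
    (1 / 3 : ℝ) • (p + q + r) ∈ Metric.ball p B := by
  rw [Metric.mem_ball, dist_eq_norm]
  have e : (1 / 3 : ℝ) • (p + q + r) - p = (1 / 3 : ℝ) • ((q - p) + (r - p)) := by module
  have h1 := norm_add_sq_real (q - p) (r - p)
  rw [h.inner_eq, h.norm_left, h.norm_right] at h1
  rw [e, norm_smul, Real.norm_of_nonneg (by norm_num)]
  nlinarith [norm_nonneg ((q - p) + (r - p))]

lemma IsEquilateral.isConvexRegion (hB : 0 < B) (h : IsEquilateral B p q r) :
    IsConvexRegion (reuleaux B p q r) where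
  convex := ((convex_closedBall _ _).inter (convex_closedBall _ _)).inter (convex_closedBall _ _)
  isCompact := ((isCompact_closedBall _ _).inter_right Metric.isClosed_closedBall).inter_right
    Metric.isClosed_closedBall
  nonempty_interior := by
    refine ⟨(1 / 3 : ℝ) • (p + q + r), ?_⟩
    rw [reuleaux, interior_inter, interior_inter]
    have e1 : p + q + r = q + r + p := by abel
    have e2 : p + q + r = r + p + q := by abel
    refine ⟨⟨Metric.ball_subset_interior_closedBall (h.center_mem_ball hB),
      Metric.ball_subset_interior_closedBall ?_⟩, Metric.ball_subset_interior_closedBall ?_⟩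
    · rw [e1]; exact h.rotate.center_mem_ball hB
    · rw [e2]; exact h.rotate.rotate.center_mem_ball hB

/-- A set of constant width that contains the vertices of a Reuleaux triangle of the same width
is that Reuleaux triangle. -/
lemma IsEquilateral.eq_reuleaux (hB : 0 < B) (h : IsEquilateral B p q r) {K : Set Plane}
    (hK : IsConvexRegion K) (hw : HasConstantWidth K B) (hp : p ∈ K) (hq : q ∈ K) (hr : r ∈ K) :
    K = reuleaux B p q r := by
  have hsub : K ⊆ reuleaux B p q r := fun x hx =>
    ⟨⟨dist_le_of_hasConstantWidth hK hw hB hx hp, dist_le_of_hasConstantWidth hK hw hB hx hq⟩,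
      dist_le_of_hasConstantWidth hK hw hB hx hr⟩
  refine Set.Subset.antisymm hsub fun t ht => ?_
  by_contra htK
  obtain ⟨f, c, hf, hft⟩ := geometric_hahn_banach_closed_point hK.convex hK.isCompact.isClosed htK
  set w : Plane := (InnerProductSpace.toDual ℝ Plane).symm f with hw_def
  have hfw : ∀ y, f y = inner ℝ w y := fun y => by
    rw [hw_def, InnerProductSpace.toDual_symm_apply]
  have hw0 : ‖w‖ ≠ 0 := by
    intro h0
    rw [norm_eq_zero] at h0
    have h1 := hf p hp
    rw [hfw, h0, inner_zero_left] at h1 hft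
    exact lt_asymm h1 hft
  have hwpos : 0 < ‖w‖ := lt_of_le_of_ne (norm_nonneg _) hw0.symm
  have hu : ‖‖w‖⁻¹ • w‖ = 1 := by rw [norm_smul, norm_inv, norm_norm, inv_mul_cancel₀ hw0]
  -- The point `t` lies beyond the highest point of `K`, hence more than `B` above its lowest point
  -- `y`. Both `t` and `y` are in the Reuleaux triangle, whose diameter is at most `B`.
  obtain ⟨x, hx, hxm⟩ := hK.exists_max (‖w‖⁻¹ • w)
  obtain ⟨y, hy, hym⟩ := hK.exists_min (‖w‖⁻¹ • w)
  have h1 := inner_sub_inner_eq hK hw hu hx hxm hy hym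
  have h2 : inner ℝ (‖w‖⁻¹ • w) x < inner ℝ (‖w‖⁻¹ • w) t := by
    rw [real_inner_smul_left, real_inner_smul_left, ← hfw, ← hfw]
    exact mul_lt_mul_of_pos_left ((hf x hx).trans hft) (inv_pos.2 hwpos)
  have h3 := dist_le_of_hasConstantWidth (h.isConvexRegion hB) (h.hasConstantWidth hB) hB ht
    (hsub hy)
  have h4 := real_inner_le_norm (‖w‖⁻¹ • w) (t - y)
  rw [hu, one_mul, inner_sub_right, ← dist_eq_norm] at h4
  linarith

end Reuleaux

/-! ### Minimal sets contain a Reuleaux triangle -/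

section Minimal

variable {K : Set Plane} {B : ℝ} {x : ℝ → Plane} {θ : ℝ} {z : Plane}

/-- Adjacent vertices share a tangent line. If both were in `K`, both would be the end of the normal
of length `B` from one opposite contact point, and so coincide. -/
lemma IsHexagonCenter.not_mem_succ (hK : IsConvexRegion K) (hw : HasConstantWidth K B)
    (hB : 0 < B) (hx : IsContactMap K B x) (hz : IsHexagonCenter B x θ z) {i : ℕ}
    (hi : hexVertex B θ z i ∈ K) : hexVertex B θ z (i + 1) ∉ K := by
  intro hi1
  obtain ⟨y, hy, hym⟩ := hK.exists_min (dir (grid θ 3 (i + 1)))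
  have h1 := eq_sub_smul_of_extremal hK hw hB (norm_dir _) hi
    (fun k hk => by rw [hz.inner_right]; exact hx.le _ k hk) hy hym
  have h2 := eq_sub_smul_of_extremal hK hw hB (norm_dir _) hi1
    (fun k hk => by rw [hz.inner_left]; exact hx.le _ k hk) hy hym
  have h3 : hexVertex B θ z i - hexVertex B θ z (i + 1) = 0 :=
    sub_eq_zero.2 (sub_left_injective (h1.symm.trans h2))
  have h4 := hexVertex_sub_succ B θ z i (dir (grid θ 3 (i + 1)))
  rw [h3, cross_zero_left, real_inner_self_eq_norm_sq, norm_dir] at h4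
  have : 0 < B / √3 := by positivity
  linarith

lemma dist_hexVertex (hB : 0 ≤ B) (θ : ℝ) (z : Plane) (i : ℕ) :
    dist (hexVertex B θ z i) (hexVertex B θ z (i + 2)) = B := by
  have e : grid θ 3 (i + 2) + Real.pi / 6 - (grid θ 3 i + Real.pi / 6) =
      Real.pi - Real.pi / 3 := by
    simp only [grid]; push_cast; ring
  rw [dist_eq_norm, hexVertex, hexVertex, add_sub_add_left_eq_sub, ← smul_sub, norm_smul]
  have h1 := norm_sub_sq_real (dir (grid θ 3 i + Real.pi / 6))
    (dir (grid θ 3 (i + 2) + Real.pi / 6))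
  rw [inner_dir_dir, e, Real.cos_pi_sub, Real.cos_pi_div_three, norm_dir, norm_dir] at h1
  have h2 : ‖dir (grid θ 3 i + Real.pi / 6) - dir (grid θ 3 (i + 2) + Real.pi / 6)‖ = √3 := by
    rw [eq_comm, Real.sqrt_eq_iff_mul_self_eq (by norm_num) (norm_nonneg _), ← sq, h1]
    norm_num
  rw [h2, Real.norm_of_nonneg (by positivity)]
  field_simp

lemma isEquilateral_hexVertex (hB : 0 ≤ B) (θ : ℝ) (z : Plane) (i : ℕ) :
    IsEquilateral B (hexVertex B θ z i) (hexVertex B θ z (i + 2)) (hexVertex B θ z (i + 4)) :=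
  ⟨dist_hexVertex hB θ z i, dist_hexVertex hB θ z (i + 2), by
    rw [← hexVertex_add_six B θ z i]; exact dist_hexVertex hB θ z (i + 4)⟩

theorem isReuleauxTriangle_of_minimal (hK : IsConvexRegion K) (hw : HasConstantWidth K B)
    (hB : 0 < B) (hmin : 2 * volume.real K ≤ (Real.pi - √3) * B ^ 2) :
    IsReuleauxTriangle K B := by
  obtain ⟨x, hx⟩ := exists_isContactMap hK hw hB
  obtain ⟨θ, z, hz⟩ := hx.exists_hexagon hK.isCompact
  replace hz : IsHexagonCenter B x θ z := hz
  have hor := fun i (hi : i < 6) => hz.mem_or_mem hK hx hmin hi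
  have hnot := fun i => hz.not_mem_succ hK hw hB hx (i := i)
  have fin : ∀ i, hexVertex B θ z i ∈ K → hexVertex B θ z (i + 2) ∈ K →
      hexVertex B θ z (i + 4) ∈ K → IsReuleauxTriangle K B := by
    intro i h0 h2 h4
    have he := isEquilateral_hexVertex hB.le θ z i
    exact ⟨_, _, _, he.dist_pq, he.dist_qr, he.dist_rp, he.eq_reuleaux hB hK hw h0 h2 h4⟩
  -- One of each opposite pair and no two neighbours: only the even or the odd vertices remain.
  by_cases h0 : hexVertex B θ z 0 ∈ K
  · have h4 := (hor 1 (by norm_num)).resolve_left (hnot 0 h0)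
    have h2 := (hor 2 (by norm_num)).resolve_right (hnot 4 h4)
    exact fin 0 h0 h2 h4
  · have h3 := (hor 0 (by norm_num)).resolve_left h0
    have h1 := (hor 1 (by norm_num)).resolve_right (hnot 3 h3)
    have h5 := (hor 2 (by norm_num)).resolve_left fun h2 => hnot 2 h2 h3
    exact fin 1 h1 h3 h5

end Minimal

/-! ### The area of a Reuleaux triangle -/

/-- The circular sector of radius `B` from the direction `a` (included) to `b` (excluded). -/
def sector (B : ℝ) (a b : Plane) : Set Plane :=
  {c | 0 < cross c b ∧ 0 ≤ cross a c ∧ ‖c‖ ≤ B}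

lemma measurableSet_sector (B : ℝ) (a b : Plane) : MeasurableSet (sector B a b) := by
  have h1 : Continuous fun c => cross c b := continuous_cross continuous_id continuous_const
  have h2 : Continuous fun c => cross a c := continuous_cross continuous_const continuous_id
  exact (isOpen_lt continuous_const h1).measurableSet.inter
    ((isClosed_le continuous_const h2).measurableSet.inter
      (isClosed_le continuous_norm continuous_const).measurableSet)

lemma sector_subset_closedBall (B : ℝ) (a b : Plane) :
    sector B a b ⊆ Metric.closedBall 0 B := fun c hc => by
  rw [mem_closedBall_zero_iff]; exact hc.2.2

lemma volume_sector_ne_top (B : ℝ) (a b : Plane) : volume (sector B a b) ≠ ⊤ :=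
  ((measure_mono (sector_subset_closedBall B a b)).trans_lt measure_closedBall_lt_top).ne

/-- The rotation by the angle `π / 3`. -/
noncomputable def rot : Plane →ₗ[ℝ] Plane :=
  Matrix.toLpLin 2 2 !![1 / 2, -(√3 / 2); √3 / 2, 1 / 2]

lemma rot_zero (c : Plane) : rot c 0 = c 0 / 2 - √3 / 2 * c 1 := by
  simp [rot, Matrix.toLpLin_apply, dotProduct, Fin.sum_univ_two]
  ring

lemma rot_one (c : Plane) : rot c 1 = √3 / 2 * c 0 + c 1 / 2 := by
  simp [rot, Matrix.toLpLin_apply, dotProduct, Fin.sum_univ_two]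
  ring

lemma sqrt_three_mul_self : √3 * √3 = (3 : ℝ) := Real.mul_self_sqrt (by norm_num)

lemma cross_rot (c d : Plane) : cross (rot c) (rot d) = cross c d := by
  simp only [cross, rot_zero, rot_one]
  linear_combination (c 0 * d 1 - c 1 * d 0) / 4 * sqrt_three_mul_self

lemma norm_rot (c : Plane) : ‖rot c‖ = ‖c‖ := by
  have h : ‖rot c‖ ^ 2 = ‖c‖ ^ 2 := by
    simp only [norm_sq_eq, rot_zero, rot_one]
    linear_combination (c 0 ^ 2 + c 1 ^ 2) / 4 * sqrt_three_mul_self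
  exact (sq_eq_sq₀ (norm_nonneg _) (norm_nonneg _)).1 h

lemma rot_rot (c : Plane) : rot (rot c) = rot c - c := by
  apply plane_ext
  · simp only [PiLp.sub_apply, rot_zero, rot_one]
    linear_combination -(c 0) / 4 * sqrt_three_mul_self
  · simp only [PiLp.sub_apply, rot_zero, rot_one]
    linear_combination -(c 1) / 4 * sqrt_three_mul_self

lemma det_rot : LinearMap.det rot = 1 := by
  rw [rot, Matrix.toLpLin_eq_toLin, LinearMap.det_toLin, Matrix.det_fin_two_of]
  linear_combination (1 / 4 : ℝ) * sqrt_three_mul_self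

lemma volume_sector_rot (B : ℝ) (a b : Plane) :
    volume (sector B (rot a) (rot b)) = volume (sector B a b) := by
  have h := Measure.addHaar_preimage_linearMap (volume : Measure Plane) (f := rot)
    (by rw [det_rot]; exact one_ne_zero) (sector B (rot a) (rot b))
  rw [det_rot, inv_one, abs_one, ENNReal.ofReal_one, one_mul] at h
  rw [← h]
  congr 1
  ext c
  change (0 < cross (rot c) (rot b) ∧ 0 ≤ cross (rot a) (rot c) ∧ ‖rot c‖ ≤ B) ↔ _
  rw [cross_rot, cross_rot, norm_rot]
  rfl

lemma rot_eq_of_inner {a b : Plane} {B : ℝ} (hB : 0 < B) (ha : ‖a‖ = B)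
    (hab : inner ℝ a b = B ^ 2 / 2) (hcr : cross a b = √3 / 2 * B ^ 2) : rot a = b := by
  have hB2 : (B ^ 2 : ℝ) ≠ 0 := by positivity
  have h1 := norm_sq_eq a
  rw [ha] at h1
  rw [inner_eq] at hab
  rw [cross] at hcr
  apply plane_ext
  · rw [rot_zero]
    apply mul_left_cancel₀ hB2
    linear_combination -a 0 * hab + a 1 * hcr - b 0 * h1
  · rw [rot_one]
    apply mul_left_cancel₀ hB2
    linear_combination -a 1 * hab - a 0 * hcr - b 1 * h1

/-- Six rotated copies of a sector of angle `π / 3` fit into a disk. -/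
lemma six_mul_volume_sector_le {B : ℝ} (hB : 0 < B) (a : Plane) :
    6 * volume.real (sector B a (rot a)) ≤ Real.pi * B ^ 2 := by
  set b := rot a with hb
  have hrb : rot b = b - a := rot_rot a
  have hrr : rot (b - a) = -a := by rw [map_sub, hrb, ← hb]; abel
  set σ := volume (sector B a b) with hσ
  have v1 : volume (sector B b (b - a)) = σ := by
    have h := volume_sector_rot B a b
    rwa [← hb, hrb] at h
  have v2 : volume (sector B (b - a) (-a)) = σ := by
    have h := volume_sector_rot B b (b - a)
    rw [hrb, hrr] at h
    rw [h, v1]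
  -- The rays of `a`, `b`, `b - a`, `-a` are successive turns by π/3. The union lies in a closed
  -- half plane and keeps only one of the two boundary rays, so it is disjoint from its negative.
  set H := sector B a b ∪ sector B b (b - a) ∪ sector B (b - a) (-a) with hH
  have hneg : ∀ c d : Plane, cross c (-d) = -cross c d := by
    intro c d; simp only [cross, PiLp.neg_apply]; ring
  have mem1 : ∀ c, c ∈ sector B b (b - a) ↔
      0 < cross a c - cross b c ∧ 0 ≤ cross b c ∧ ‖c‖ ≤ B := by
    intro c
    change (0 < cross c (b - a) ∧ 0 ≤ cross b c ∧ ‖c‖ ≤ B) ↔ _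
    rw [cross_sub_right, cross_comm c b, cross_comm c a]
    ring_nf
  have mem2 : ∀ c, c ∈ sector B (b - a) (-a) ↔
      0 < cross a c ∧ 0 ≤ cross b c - cross a c ∧ ‖c‖ ≤ B := by
    intro c
    change (0 < cross c (-a) ∧ 0 ≤ cross (b - a) c ∧ ‖c‖ ≤ B) ↔ _
    rw [cross_sub_left, hneg, cross_comm c a, neg_neg]
  have mem0 : ∀ c, c ∈ sector B a b ↔ 0 < -cross b c ∧ 0 ≤ cross a c ∧ ‖c‖ ≤ B := by
    intro c
    change (0 < cross c b ∧ 0 ≤ cross a c ∧ ‖c‖ ≤ B) ↔ _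
    rw [cross_comm c b]
  have d1 : Disjoint (sector B a b) (sector B b (b - a)) := by
    rw [Set.disjoint_left]
    intro c h1 h2
    rw [mem0] at h1
    rw [mem1] at h2
    linarith [h1.1, h2.2.1]
  have d2 : Disjoint (sector B a b ∪ sector B b (b - a)) (sector B (b - a) (-a)) := by
    rw [Set.disjoint_left]
    rintro c (h1 | h1) h2
    · rw [mem0] at h1
      rw [mem2] at h2
      linarith [h1.1, h1.2.1, h2.2.1]
    · rw [mem1] at h1
      rw [mem2] at h2
      linarith [h1.1, h2.2.1]
  have hHmem : ∀ c ∈ H, 0 ≤ cross a c ∧ (0 < cross a c ∨ cross b c < 0) := by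
    rintro c ((h | h) | h)
    · rw [mem0] at h
      exact ⟨h.2.1, Or.inr (by linarith [h.1])⟩
    · rw [mem1] at h
      exact ⟨by linarith [h.1, h.2.1], Or.inl (by linarith [h.1, h.2.1])⟩
    · rw [mem2] at h
      exact ⟨h.1.le, Or.inl h.1⟩
  have hHmeas : MeasurableSet H :=
    ((measurableSet_sector _ _ _).union (measurableSet_sector _ _ _)).union
      (measurableSet_sector _ _ _)
  have hHvol : volume H = 3 * σ := by
    rw [hH, measure_union d2 (measurableSet_sector _ _ _),
      measure_union d1 (measurableSet_sector _ _ _), v1, v2]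
    ring
  have hHneg : volume ((fun c => -c) ⁻¹' H) = volume H :=
    (Measure.measurePreserving_neg volume).measure_preimage hHmeas.nullMeasurableSet
  have d3 : Disjoint H ((fun c => -c) ⁻¹' H) := by
    rw [Set.disjoint_left]
    intro c h1 h2
    have h3 := hHmem c h1
    have h4 := hHmem _ h2
    rw [hneg, hneg] at h4
    rcases h3.2 with h | h <;> rcases h4.2 with h' | h' <;> linarith [h3.1, h4.1]
  have hHball : H ⊆ Metric.closedBall 0 B := by
    rintro c ((h | h) | h) <;> exact sector_subset_closedBall _ _ _ h
  have hball : H ∪ ((fun c => -c) ⁻¹' H) ⊆ Metric.closedBall 0 B := by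
    refine Set.union_subset hHball fun c hc => ?_
    have := hHball hc
    rwa [mem_closedBall_zero_iff, norm_neg, ← mem_closedBall_zero_iff] at this
  have h := measure_mono (μ := volume) hball
  rw [measure_union d3 (hHmeas.preimage measurable_neg), hHneg, hHvol,
    EuclideanSpace.volume_closedBall_fin_two] at h
  have hσtop : σ ≠ ⊤ := volume_sector_ne_top B a b
  have h' := ENNReal.toReal_mono (by finiteness) h
  rw [← two_mul, ENNReal.toReal_mul, ENNReal.toReal_mul, ENNReal.toReal_mul, ENNReal.toReal_pow,
    ENNReal.toReal_ofReal hB.le] at h'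
  simp only [ENNReal.toReal_ofNat, ENNReal.toReal_ofReal Real.pi_pos.le] at h'
  change 6 * σ.toReal ≤ _
  linarith

section Reuleaux

variable {B : ℝ} {p q r : Plane}

lemma IsEquilateral.cross_eq (h : IsEquilateral B p q r)
    (hpos : 0 < cross (q - p) (r - p)) : cross (q - p) (r - p) = √3 / 2 * B ^ 2 := by
  refine (sq_eq_sq₀ hpos.le (by positivity)).1 ?_
  rw [h.cross_sq]
  linear_combination -(B ^ 4 / 4) * sqrt_three_mul_self

lemma cross_sub_rotate (p q r : Plane) :
    cross (r - q) (p - q) = cross (q - p) (r - p) := by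
  simp only [cross, PiLp.sub_apply]; ring

lemma volume_preimage_sub {S : Set Plane} (hS : MeasurableSet S) (p : Plane) :
    volume.real ((fun x => x - p) ⁻¹' S) = volume.real S := by
  rw [measureReal_def, (measurePreserving_sub_right volume p).measure_preimage
    hS.nullMeasurableSet, measureReal_def]

lemma IsEquilateral.volume_sector_le (hB : 0 < B) (h : IsEquilateral B p q r)
    (hpos : 0 < cross (q - p) (r - p)) :
    6 * volume.real ((fun x => x - p) ⁻¹' sector B (q - p) (r - p)) ≤ Real.pi * B ^ 2 := by
  rw [volume_preimage_sub (measurableSet_sector _ _ _),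
    ← rot_eq_of_inner hB h.norm_left h.inner_eq (h.cross_eq hpos)]
  exact six_mul_volume_sector_le hB _

lemma tri_subset_closedBall {a b : Plane} (hB : 0 ≤ B) (ha : ‖a‖ ≤ B) (hb : ‖b‖ ≤ B) :
    tri a b ⊆ Metric.closedBall 0 B := fun c hc => by
  have h := add_mem_of_mem_tri (convex_closedBall (0 : Plane) B) (o := 0)
    (Metric.mem_closedBall_self hB) (by simpa using ha) (by simpa using hb) hc
  rwa [zero_add] at h

lemma IsEquilateral.le_volume_tri (hB : 0 < B) (h : IsEquilateral B p q r)
    (hpos : 0 < cross (q - p) (r - p)) :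
    √3 / 2 * B ^ 2 ≤ 2 * volume.real ((fun x => x - p) ⁻¹' tri (q - p) (r - p)) := by
  rw [volume_preimage_sub (measurableSet_tri _ _), ← h.cross_eq hpos]
  have hfin : volume (tri (q - p) (r - p)) ≠ ⊤ :=
    ((measure_mono (tri_subset_closedBall hB.le h.norm_left.le h.norm_right.le)).trans_lt
      measure_closedBall_lt_top).ne
  have h1 := (ENNReal.ofReal_le_iff_le_toReal (ENNReal.mul_ne_top (by simp) hfin)).1
    (ofReal_cross_le_volume_tri (q - p) (r - p))
  rwa [ENNReal.toReal_mul, ENNReal.toReal_ofNat] at h1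

/-- The normal cones at the vertices of a Reuleaux triangle, in barycentric coordinates. -/
lemma IsEquilateral.barycentric_nonneg (hB : 0 < B) (h : IsEquilateral B p q r)
    (hpos : 0 < cross (q - p) (r - p)) {x : Plane} (hx : x ∈ reuleaux B p q r) :
    0 ≤ 2 * cross (x - p) (r - p) + cross (q - p) (x - p) ∧
      0 ≤ cross (x - p) (r - p) + 2 * cross (q - p) (x - p) := by
  rw [BlaschkeLebesgue.mem_reuleaux] at hx
  have h1 := inner_nonneg_of_norm_sub_le h.norm_left hx.2.1
  have h2 := inner_nonneg_of_norm_sub_le h.norm_right hx.2.2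
  have hc := cross_smul_eq (q - p) (r - p) (x - p)
  have hB2 : 0 < B ^ 2 / 2 := by positivity
  have e1 := congrArg (inner ℝ (q - p)) hc
  have e2 := congrArg (inner ℝ (r - p)) hc
  rw [real_inner_smul_right, inner_add_right, real_inner_smul_right, real_inner_smul_right,
    real_inner_self_eq_norm_sq, h.norm_left, h.inner_eq] at e1
  rw [real_inner_smul_right, inner_add_right, real_inner_smul_right, real_inner_smul_right,
    real_inner_self_eq_norm_sq, h.norm_right, real_inner_comm (q - p) (r - p), h.inner_eq] at e2
  have k1 := mul_nonneg hpos.le h1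
  have k2 := mul_nonneg hpos.le h2
  constructor
  · refine nonneg_of_mul_nonneg_right (a := B ^ 2 / 2) ?_ hB2
    linarith
  · refine nonneg_of_mul_nonneg_right (a := B ^ 2 / 2) ?_ hB2
    linarith

lemma cross_rotate_left (p q x : Plane) :
    cross (x - q) (p - q) = cross (q - p) (x - p) := by
  simp only [cross, PiLp.sub_apply]; ring

lemma cross_rotate_right (p q r x : Plane) : cross (r - q) (x - q) =
    cross (q - p) (r - p) - cross (x - p) (r - p) - cross (q - p) (x - p) := by
  simp only [cross, PiLp.sub_apply]; ring

lemma IsEquilateral.tri_subset_sector (hB : 0 < B) (h : IsEquilateral B p q r) :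
    (fun x => x - p) ⁻¹' tri (q - p) (r - p) ⊆
      ((fun x => x - p) ⁻¹' sector B (q - p) (r - p)) ∩
        ((fun x => x - q) ⁻¹' sector B (r - q) (p - q)) := by
  intro x hx
  have hm := add_mem_of_mem_tri ((convex_closedBall p B).inter (convex_closedBall q B)) (o := p)
    (c := x - p) ⟨Metric.mem_closedBall_self hB.le, h.dist_pq.le⟩
    (by rw [add_sub_cancel]
        exact ⟨by rw [Metric.mem_closedBall, dist_comm]; exact h.dist_pq.le,
          Metric.mem_closedBall_self hB.le⟩)
    (by rw [add_sub_cancel]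
        exact ⟨h.dist_rp.le, by rw [Metric.mem_closedBall, dist_comm]; exact h.dist_qr.le⟩) hx
  rw [add_sub_cancel, Set.mem_inter_iff, Metric.mem_closedBall, Metric.mem_closedBall,
    dist_eq_norm, dist_eq_norm] at hm
  obtain ⟨h1, h2, h3⟩ := hx
  refine ⟨⟨h1, h2.le, hm.1⟩, ?_, ?_, hm.2⟩
  · rw [cross_rotate_left p q]; exact h2
  · rw [cross_rotate_right p q r]; linarith

lemma IsEquilateral.reuleaux_subset_sectors (hB : 0 < B) (h : IsEquilateral B p q r)
    (hpos : 0 < cross (q - p) (r - p)) :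
    reuleaux B p q r ⊆ ((fun x => x - p) ⁻¹' sector B (q - p) (r - p)) ∪
      ((fun x => x - q) ⁻¹' sector B (r - q) (p - q)) ∪
        ((fun x => x - r) ⁻¹' sector B (p - r) (q - r)) := by
  intro x hx
  have hqpos : 0 < cross (r - q) (p - q) := by rwa [cross_sub_rotate]
  have hrpos : 0 < cross (p - r) (q - r) := by rwa [cross_sub_rotate]
  have b1 := h.barycentric_nonneg hB hpos hx
  have b2 := h.rotate.barycentric_nonneg hB hqpos (by rwa [reuleaux_rotate])
  have b3 := h.rotate.rotate.barycentric_nonneg hB hrpos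
    (by rwa [reuleaux_rotate, reuleaux_rotate])
  have hn := BlaschkeLebesgue.mem_reuleaux.1 hx
  have q1 := cross_rotate_left p q x
  have q2 := cross_rotate_right p q r x
  have r1 := cross_rotate_left q r x
  have r2 : cross (p - r) (x - r) = cross (x - p) (r - p) := by
    simp only [cross, PiLp.sub_apply]; ring
  rw [r1, r2] at b3
  rw [q1] at b2
  have hsum : cross (r - q) (x - q) + cross (x - p) (r - p) + cross (q - p) (x - p) =
    cross (q - p) (r - p) := by linarith
  clear q2
  have m1 : 0 < cross (x - p) (r - p) → 0 ≤ cross (q - p) (x - p) →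
      x ∈ (fun x => x - p) ⁻¹' sector B (q - p) (r - p) := fun h1 h2 => ⟨h1, h2, hn.1⟩
  have m2 : 0 < cross (q - p) (x - p) → 0 ≤ cross (r - q) (x - q) →
      x ∈ (fun x => x - q) ⁻¹' sector B (r - q) (p - q) := fun h1 h2 =>
    ⟨by rw [q1]; exact h1, h2, hn.2.1⟩
  have m3 : 0 < cross (r - q) (x - q) → 0 ≤ cross (x - p) (r - p) →
      x ∈ (fun x => x - r) ⁻¹' sector B (p - r) (q - r) := fun h1 h2 =>
    ⟨by rw [r1]; exact h1, by rw [r2]; exact h2, hn.2.2⟩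
  by_contra hcon
  rw [Set.mem_union, Set.mem_union, not_or, not_or] at hcon
  obtain ⟨⟨c1, c2⟩, c3⟩ := hcon
  have k1 : 0 < cross (x - p) (r - p) → cross (q - p) (x - p) < 0 := fun h1 =>
    lt_of_not_ge fun h2 => c1 (m1 h1 h2)
  have k2 : 0 < cross (q - p) (x - p) → cross (r - q) (x - q) < 0 := fun h1 =>
    lt_of_not_ge fun h2 => c2 (m2 h1 h2)
  have k3 : 0 < cross (r - q) (x - q) → cross (x - p) (r - p) < 0 := fun h1 =>
    lt_of_not_ge fun h2 => c3 (m3 h1 h2)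
  -- The three cross products are unnormalized barycentric coordinates. If one is positive, the
  -- excluded sectors and the vertex cones force a cycle of signs that contradicts itself; so all
  -- are nonpositive, against their positive sum.
  have l1 : cross (x - p) (r - p) ≤ 0 := by
    by_contra! h1
    have h2 := k1 h1
    have h3 := k3 (by linarith [b2.1])
    linarith
  have l2 : cross (q - p) (x - p) ≤ 0 := by
    by_contra! h1
    have h2 := k2 h1
    have h3 := k1 (by linarith [b3.1])
    linarith
  have l3 : cross (r - q) (x - q) ≤ 0 := by
    by_contra! h1
    have h2 := k3 h1
    have h3 := k2 (by linarith [b1.1])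
    linarith
  linarith

lemma IsEquilateral.volume_le_of_pos (hB : 0 < B) (h : IsEquilateral B p q r)
    (hpos : 0 < cross (q - p) (r - p)) :
    2 * volume.real (reuleaux B p q r) ≤ (Real.pi - √3) * B ^ 2 := by
  have hq := h.rotate
  have hr := h.rotate.rotate
  have hqpos : 0 < cross (r - q) (p - q) := by rwa [cross_sub_rotate]
  have hrpos : 0 < cross (p - r) (q - r) := by rwa [cross_sub_rotate]
  have hsub := h.reuleaux_subset_sectors hB hpos
  have hTp := h.tri_subset_sector hB
  have hTq := hq.tri_subset_sector hB
  have vp := h.volume_sector_le hB hpos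
  have vq := hq.volume_sector_le hB hqpos
  have vr := hr.volume_sector_le hB hrpos
  have tp := h.le_volume_tri hB hpos
  have tq := hq.le_volume_tri hB hqpos
  have mT : ∀ o a b : Plane, MeasurableSet ((fun x => x - o) ⁻¹' tri a b) := fun o a b =>
    (measurableSet_tri a b).preimage (measurable_id.sub_const o)
  have fS : ∀ o a b : Plane, volume ((fun x => x - o) ⁻¹' sector B a b) ≠ ⊤ := fun o a b => by
    rw [(measurePreserving_sub_right volume o).measure_preimage
      (measurableSet_sector B a b).nullMeasurableSet]
    exact volume_sector_ne_top B a b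
  have mTp := mT p (q - p) (r - p)
  have mTq := mT q (r - q) (p - q)
  have fp := fS p (q - p) (r - p)
  have fq := fS q (r - q) (p - q)
  have fr := fS r (p - r) (q - r)
  clear mT fS
  generalize (fun x => x - p) ⁻¹' sector B (q - p) (r - p) = Sp at *
  generalize (fun x => x - q) ⁻¹' sector B (r - q) (p - q) = Sq at *
  generalize (fun x => x - r) ⁻¹' sector B (p - r) (q - r) = Sr at *
  generalize (fun x => x - p) ⁻¹' tri (q - p) (r - p) = Tp at *
  generalize (fun x => x - q) ⁻¹' tri (r - q) (p - q) = Tq at *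
  -- The triangle lies in every sector and need be counted once only: three sectors minus two
  -- triangles give B²(π/2 - √3/2).
  have hcover : reuleaux B p q r ⊆ Sp ∪ Sq \ Tp ∪ Sr \ Tq := by
    intro x hx
    have hxq : x ∈ Sq → x ∈ Sp ∪ Sq \ Tp ∪ Sr \ Tq := fun hx => by
      by_cases hxT : x ∈ Tp
      · exact Or.inl (Or.inl (hTp hxT).1)
      · exact Or.inl (Or.inr ⟨hx, hxT⟩)
    rcases hsub hx with (hx | hx) | hx
    · exact Or.inl (Or.inl hx)
    · exact hxq hx
    · by_cases hxT : x ∈ Tq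
      · exact hxq (hTq hxT).1
      · exact Or.inr ⟨hx, hxT⟩
  have d1 : volume.real (Sq \ Tp) = volume.real Sq - volume.real Tp :=
    measureReal_sdiff (fun x hx => (hTp hx).2) mTp fq
  have d2 : volume.real (Sr \ Tq) = volume.real Sr - volume.real Tq :=
    measureReal_sdiff (fun x hx => (hTq hx).2) mTq fr
  have f1 : volume (Sq \ Tp) ≠ ⊤ := measure_ne_top_of_subset Set.sdiff_subset fq
  have f2 : volume (Sr \ Tq) ≠ ⊤ := measure_ne_top_of_subset Set.sdiff_subset fr
  have hle := measureReal_mono (μ := volume) hcover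
    (measure_union_ne_top (measure_union_ne_top fp f1) f2)
  have hu1 := measureReal_union_le (μ := volume) (Sp ∪ Sq \ Tp) (Sr \ Tq)
  have hu2 := measureReal_union_le (μ := volume) Sp (Sq \ Tp)
  linarith

theorem IsEquilateral.volume_le (hB : 0 < B) (h : IsEquilateral B p q r) :
    2 * volume.real (reuleaux B p q r) ≤ (Real.pi - √3) * B ^ 2 := by
  rcases lt_trichotomy 0 (cross (q - p) (r - p)) with hpos | h0 | hneg
  · exact h.volume_le_of_pos hB hpos
  · have h1 := h.cross_sq
    rw [← h0] at h1
    have : 0 < B ^ 4 := by positivity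
    linarith
  · rw [← reuleaux_swap]
    exact h.swap.volume_le_of_pos hB (by rw [cross_comm]; linarith)

end Reuleaux

end BlaschkeLebesgue

open BlaschkeLebesgue

theorem corollary2 (B : ℝ) (hB : 0 < B) :
    (∃ T : Set BlaschkeLebesgue.Plane, BlaschkeLebesgue.IsReuleauxTriangle T B) ∧
    ∀ T : Set BlaschkeLebesgue.Plane, BlaschkeLebesgue.IsReuleauxTriangle T B →
      BlaschkeLebesgue.IsConvexRegion T ∧
      BlaschkeLebesgue.HasConstantWidth T B ∧
      ∀ K : Set BlaschkeLebesgue.Plane, BlaschkeLebesgue.IsConvexRegion K →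
        BlaschkeLebesgue.HasConstantWidth K B →
        MeasureTheory.volume T ≤ MeasureTheory.volume K ∧
        (MeasureTheory.volume K = MeasureTheory.volume T →
          BlaschkeLebesgue.IsReuleauxTriangle K B) := by
  constructor
  · have h := isEquilateral_hexVertex hB.le 0 0 0
    exact ⟨_, _, _, _, h.dist_pq, h.dist_qr, h.dist_rp, rfl⟩
  rintro T ⟨p, q, r, hpq, hqr, hrp, rfl⟩
  have h : IsEquilateral B p q r := ⟨hpq, hqr, hrp⟩
  have hT := h.isConvexRegion hB
  have hvol := h.volume_le hB
  refine ⟨hT, h.hasConstantWidth hB, fun K hK hw => ?_⟩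
  obtain ⟨x, hx⟩ := exists_isContactMap hK hw hB
  have hlow := hx.le_volume hK
  constructor
  · refine (ENNReal.toReal_le_toReal hT.isCompact.measure_ne_top hK.isCompact.measure_ne_top).1 ?_
    change volume.real (reuleaux B p q r) ≤ volume.real K
    linarith
  · intro heq
    refine isReuleauxTriangle_of_minimal hK hw hB ?_
    rw [measureReal_def, heq]
    exact hvol
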